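/- Let $PW_\pi$ be the space of functions $f\in L^2(\mathbb R)$ (complex valued) whose Fourier transform $\widehat f(\xi)=\int_{\mathbb R} f(x)e^{-2\pi i x\xi}\,dx$ (in the $L^2$ sense) vanishes almost everywhere outside $[-\tfrac12,\tfrac12]$; each such $f$ is identified with its continuous representative. Let $\mathrm{sinc}(x)=\frac{\sin(\pi x)}{\pi x}$, $\mathrm{sinc}(0)=1$. Fix an integer $N\ge 1$, let $C^N_1,\dots,C^N_N$ be the coefficients determined by $$\prod_{j=1}^{N-1}\Big(y+\pi i-\frac{2\pi i j}{N}\Big)=\sum_{m=1}^N C^N_m\,y^{m-1},$$ and for $1\le m\le N$ put $$g_m^N(x)=\Big(\sum_{n=m}^N C_n^N\frac{(n-1)!}{(N-1)!}x^{N-n}\Big)\frac{x^{m-1}}{(m-1)!}\,\mathrm{sinc}\Big(\frac xN\Big)^N .$$ Then: (a) For each $n=1,\dots,N$ one has $g_n^N\in PW_\pi$, and $g^N_n$ is the unique $h\in PW_\pi$ with $h^{(k-1)}(Nj)=\delta_{k,n}\delta_{j,0}$ for all $k=1,\dots,N$ and $j\in\mathbb Z$. (b) Every $f\in PW_\pi$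 is infinitely differentiable, and for every $x\in\mathbb R$ $$f(x)=\sum_{n=1}^N\sum_{m\in\mathbb Z} f^{(n-1)}(Nm)\,g_n^N(x-Nm),$$ where for each $n$ the series over $m\in\mathbb Z$ converges unconditionally, both in $L^2(\mathbb R)$ and uniformly on $\mathbb R$. -/

import Mathlib

open scoped FourierTransform

/-- Membership in the Paley–Wiener space `PW_τ`: `f : ℝ → ℂ` is square integrable and its `L²` Fourier
transform (normalized with kernel `e^{-2πixξ}`) vanishes almost everywhere outside
`[-τ/(2π), τ/(2π)]`. Elements of `PW_τ` are evaluated at points, so `f` is the continuous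
representative of its `L²` class. -/
structure IsPaleyWiener (τ : ℝ) (f : ℝ → ℂ) : Prop where
  continuous : Continuous f
  memLp : MeasureTheory.MemLp f 2 MeasureTheory.volume
  fourier_support : ∀ᵐ ξ : ℝ, ξ ∉ Set.Icc (-(τ / (2 * Real.pi))) (τ / (2 * Real.pi)) →
    (𝓕 (memLp.toLp f) : MeasureTheory.Lp ℂ 2 (MeasureTheory.volume : MeasureTheory.Measure ℝ)) ξ = 0

/-- The normalized cardinal sine `sin (π x) / (π x)`, with value `1` at `0`. -/
noncomputable def cardSinc (x : ℝ) : ℝ := Real.sinc (Real.pi * x)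

/-- The polynomial `∏_{j=1}^{N-1} (y + π i - 2 π i j / N)` in the variable `y`. -/
noncomputable def nodePoly (N : ℕ) : Polynomial ℂ :=
  ∏ j ∈ Finset.Icc 1 (N - 1), (Polynomial.X +
    Polynomial.C (Real.pi * Complex.I - 2 * Real.pi * Complex.I * j / N))

/-- The coefficient `C^N_m` (for `1 ≤ m ≤ N`) of `y^{m-1}` in `nodePoly N`. -/
noncomputable def nodeCoeff (N m : ℕ) : ℂ := (nodePoly N).coeff (m - 1)

/-- The kernel `g^N_m` (for `1 ≤ m ≤ N`). -/
noncomputable def derivKernel (N m : ℕ) (x : ℝ) : ℂ :=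
  (∑ n ∈ Finset.Icc m N,
      nodeCoeff N n * ((Nat.factorial (n - 1) : ℂ) / (Nat.factorial (N - 1) : ℂ)) *
        (x : ℂ) ^ (N - n)) *
    ((x : ℂ) ^ (m - 1) / (Nat.factorial (m - 1) : ℂ)) * (cardSinc (x / N) : ℂ) ^ N

/-- The term `f^{(n-1)}(N m) g^N_n(x - N m)` of the interpolation series (for `1 ≤ n ≤ N`). -/
noncomputable def derivTerm (N : ℕ) (f : ℝ → ℂ) (n : ℕ) (m : ℤ) (x : ℝ) : ℂ :=
  iteratedDeriv (n - 1) f (N * m) * derivKernel N n (x - N * m)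

open MeasureTheory

/-! Everything is read on the Fourier side: `bandSynthesis` maps `L²` of the band isometrically into
`L²(ℝ)`, its range is the Paley–Wiener space, and differentiation becomes multiplication by `2πiξ`.

Uniqueness (`ae_eq_zero_of_samples_eq_zero`): cut the band into `N` intervals of length `1/N`. Up to
a factor, the samples of the `k`-th derivative on `Nℤ` are the Fourier coefficients of the folded
function `∑ l, (2πi(ξ + l/N))^k F(ξ + l/N)`. If they vanish for all `k < N`, a Vandermonde system
with distinct nodes forces `F = 0`.

Kernels: each factor `sinc (x/N)` spreads the spectrum by `1/(2N)`, and multiplication by `x` merely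
turns such a factor into two exponentials, so the kernels are band-limited
(`hasBoundedSpectrum_derivKernel`). Away from `0` the factor `sinc (x/N)^N` vanishes to order `N` at
every node. At `0` the polynomial factor is a truncated Taylor series of `sinc (x/N)^(-N)`, because
the product defining `nodePoly` is the generating function of those coefficients
(`coeff_pow_mul_expSeries`, `coeff_pow_eq_nodeCoeff`). Hence the sampled data are Kronecker deltas
(`iteratedDeriv_derivKernel`).

Series: the samples of `f` and its derivatives are square summable and the exponentials carrying the
shifts are orthonormal, so the spectral series converges unconditionally in `L²` of the band. The
isometry and a sup-norm bound transfer this to `L²(ℝ)` and to uniform convergence. The sum has the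
same samples as `f`, so it equals `f`. -/

/-! ### The Paley–Wiener space as the image of `L²` of the band. -/

/-- Normalized Lebesgue measure on the spectral band of `PW_π`. -/
noncomputable def bandMeasure : Measure ℝ := volume.restrict (Set.Ioc (-(1 / 2)) (1 / 2))

/-- The function with spectral density `F` on the band. -/
noncomputable def bandSynthesis (F : ℝ → ℂ) (x : ℝ) : ℂ :=
  ∫ ξ, Complex.exp (2 * Real.pi * Complex.I * x * ξ) * F ξ ∂bandMeasure

instance : IsProbabilityMeasure bandMeasure := by
  constructor
  simp [bandMeasure]
  norm_num

theorem fourierInv_eq_vectorFourier (G : ℝ → ℂ) :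
    𝓕⁻ G = VectorFourier.fourierIntegral Real.fourierChar volume
      (-innerₗ ℝ : ℝ →ₗ[ℝ] ℝ →ₗ[ℝ] ℝ) G := by
  ext x
  rw [Real.fourierInv_eq, VectorFourier.fourierIntegral]
  simp

theorem continuous_uncurry_neg_inner :
    Continuous fun p : ℝ × ℝ => (-innerₗ ℝ : ℝ →ₗ[ℝ] ℝ →ₗ[ℝ] ℝ) p.1 p.2 := by
  simp only [LinearMap.neg_apply, innerₗ_apply_apply]
  exact continuous_inner.neg

theorem continuous_fourierInv_of_integrable {G : ℝ → ℂ} (hG : Integrable G) :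
    Continuous (𝓕⁻ G) := by
  rw [fourierInv_eq_vectorFourier]
  exact VectorFourier.fourierIntegral_continuous Real.continuous_fourierChar
      continuous_uncurry_neg_inner hG

theorem integral_fourierInv_mul_eq {f g : ℝ → ℂ} (hf : Integrable f) (hg : Integrable g) :
    ∫ x, 𝓕⁻ f x * g x = ∫ x, f x * 𝓕⁻ g x := by
  have h := VectorFourier.integral_fourierIntegral_smul_eq_flip (μ := volume) (ν := volume)
    Real.continuous_fourierChar continuous_uncurry_neg_inner hf hg
  have hflip : (-innerₗ ℝ : ℝ →ₗ[ℝ] ℝ →ₗ[ℝ] ℝ).flip = -innerₗ ℝ := by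
    ext
    simp
  rw [hflip, ← fourierInv_eq_vectorFourier, ← fourierInv_eq_vectorFourier] at h
  simpa only [smul_eq_mul] using h

/-- The abstract `L²` inverse transform and the integral formula act identically on smooth compactly
supported test functions: in both cases the transform can be moved onto the test function. -/
theorem fourierInv_toLp_ae_eq {G : ℝ → ℂ} (h1 : Integrable G) (h2 : MemLp G 2 volume) :
    (𝓕⁻ (h2.toLp G) : Lp ℂ 2 (volume : Measure ℝ)) =ᵐ[volume] 𝓕⁻ G := by
  apply ae_eq_of_integral_contDiff_smul_eq
  · exact (Lp.memLp _).locallyIntegrable (by norm_num)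
  · exact (continuous_fourierInv_of_integrable h1).locallyIntegrable
  intro g hg hgc
  let gs : SchwartzMap ℝ ℂ := HasCompactSupport.toSchwartzMap (f := fun x => (g x : ℂ))
    (hgc.comp_left (g := fun t : ℝ => (t : ℂ)) (by simp))
    (Complex.ofRealCLM.contDiff.comp hg)
  have e1 := Lp.toTemperedDistribution_apply (𝓕⁻ (h2.toLp G) : Lp ℂ 2 (volume : Measure ℝ)) gs
  rw [← Lp.fourierInv_toTemperedDistribution_eq, TemperedDistribution.fourierInv_apply,
    Lp.toTemperedDistribution_apply] at e1
  have e2 : ∫ x, (𝓕⁻ gs) x • (h2.toLp G) x = ∫ x, (𝓕⁻ gs) x • G x := by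
    apply integral_congr_ae
    filter_upwards [h2.coeFn_toLp] with x hx
    rw [hx]
  have hgs : ∀ x, gs x = (g x : ℂ) := fun x => rfl
  rw [e2] at e1
  have e3 := integral_fourierInv_mul_eq h1 gs.integrable
  calc ∫ x, g x • (𝓕⁻ (h2.toLp G) : Lp ℂ 2 (volume : Measure ℝ)) x
      = ∫ x, gs x • (𝓕⁻ (h2.toLp G) : Lp ℂ 2 (volume : Measure ℝ)) x := by
        simp only [hgs, Complex.real_smul, smul_eq_mul]
    _ = ∫ x, G x * (𝓕⁻ (gs : ℝ → ℂ)) x := by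
        rw [← e1, ← SchwartzMap.fourierInv_coe]
        simp only [smul_eq_mul, mul_comm]
    _ = ∫ x, 𝓕⁻ G x * gs x := e3.symm
    _ = ∫ x, g x • 𝓕⁻ G x := by
        simp only [hgs, Complex.real_smul, mul_comm]

theorem bandSynthesis_eq_fourierInv (F : ℝ → ℂ) :
    bandSynthesis F = 𝓕⁻ ((Set.Ioc (-(1 / 2) : ℝ) (1 / 2)).indicator F) := by
  ext x
  rw [Real.fourierInv_eq', bandSynthesis, bandMeasure, ← integral_indicator measurableSet_Ioc]
  congr 1
  ext ξ
  by_cases h : ξ ∈ Set.Ioc (-(1 / 2) : ℝ) (1 / 2)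
  · simp only [Set.indicator_of_mem h, smul_eq_mul]
    congr 2
    simp
    ring
  · simp only [Set.indicator_of_notMem h, smul_zero]

theorem integrable_indicator_band {F : ℝ → ℂ} (hF : MemLp F 2 bandMeasure) :
    Integrable ((Set.Ioc (-(1 / 2) : ℝ) (1 / 2)).indicator F) := by
  rw [integrable_indicator_iff measurableSet_Ioc]
  exact hF.integrable one_le_two

theorem memLp_indicator_band {F : ℝ → ℂ} (hF : MemLp F 2 bandMeasure) :
    MemLp ((Set.Ioc (-(1 / 2) : ℝ) (1 / 2)).indicator F) 2 volume :=
  (memLp_indicator_iff_restrict measurableSet_Ioc).2 hF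

theorem bandSynthesis_ae_eq {F : ℝ → ℂ} (hF : MemLp F 2 bandMeasure) :
    (𝓕⁻ ((memLp_indicator_band hF).toLp _) : Lp ℂ 2 (volume : Measure ℝ)) =ᵐ[volume]
      bandSynthesis F := by
  rw [bandSynthesis_eq_fourierInv]
  exact fourierInv_toLp_ae_eq (integrable_indicator_band hF) (memLp_indicator_band hF)

theorem continuous_bandSynthesis {F : ℝ → ℂ} (hF : MemLp F 2 bandMeasure) :
    Continuous (bandSynthesis F) := by
  rw [bandSynthesis_eq_fourierInv]
  exact continuous_fourierInv_of_integrable (integrable_indicator_band hF)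

theorem eLpNorm_bandSynthesis {F : ℝ → ℂ} (hF : MemLp F 2 bandMeasure) :
    eLpNorm (bandSynthesis F) 2 volume = eLpNorm F 2 bandMeasure := by
  rw [← eLpNorm_congr_ae (bandSynthesis_ae_eq hF), ← Lp.enorm_def]
  have h : ‖(𝓕⁻ ((memLp_indicator_band hF).toLp _) : Lp ℂ 2 (volume : Measure ℝ))‖ₑ =
      ‖(memLp_indicator_band hF).toLp _‖ₑ := by
    rw [← ofReal_norm, ← ofReal_norm]
    congr 1
    exact (Lp.fourierTransformₗᵢ ℝ ℂ).symm.norm_map _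
  rw [h, Lp.enorm_toLp, eLpNorm_indicator_eq_eLpNorm_restrict measurableSet_Ioc, bandMeasure]

theorem memLp_bandSynthesis {F : ℝ → ℂ} (hF : MemLp F 2 bandMeasure) :
    MemLp (bandSynthesis F) 2 volume :=
  ⟨(continuous_bandSynthesis hF).aestronglyMeasurable,
    (eLpNorm_bandSynthesis hF).trans_lt hF.eLpNorm_lt_top⟩

theorem pi_div_two_pi : Real.pi / (2 * Real.pi) = 1 / 2 := by
  field_simp

theorem isPaleyWiener_bandSynthesis {F : ℝ → ℂ} (hF : MemLp F 2 bandMeasure) :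
    IsPaleyWiener Real.pi (bandSynthesis F) := by
  refine ⟨continuous_bandSynthesis hF, memLp_bandSynthesis hF, ?_⟩
  have h : (memLp_bandSynthesis hF).toLp (bandSynthesis F) =
      𝓕⁻ ((memLp_indicator_band hF).toLp _) := by
    apply Lp.ext
    exact (MemLp.coeFn_toLp _).trans (bandSynthesis_ae_eq hF).symm
  rw [h, FourierTransform.fourier_fourierInv_eq]
  filter_upwards [(memLp_indicator_band hF).coeFn_toLp] with ξ hξ hn
  rw [hξ, Set.indicator_of_notMem]
  rw [pi_div_two_pi] at hn
  exact fun h => hn (Set.Ioc_subset_Icc_self h)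

theorem IsPaleyWiener.exists_bandSynthesis {f : ℝ → ℂ} (hf : IsPaleyWiener Real.pi f) :
    ∃ F : ℝ → ℂ, MemLp F 2 bandMeasure ∧ f = bandSynthesis F := by
  set F : Lp ℂ 2 (volume : Measure ℝ) := 𝓕 (hf.memLp.toLp f) with hFdef
  have hF : MemLp F 2 bandMeasure := (Lp.memLp F).restrict _
  refine ⟨F, hF, ?_⟩
  have h : (memLp_indicator_band hF).toLp _ = F := by
    apply Lp.ext
    refine (MemLp.coeFn_toLp _).trans ?_
    -- The half-open band differs from the closed one in the definition by this null point.
    have h0 : ∀ᵐ ξ : ℝ, ξ ≠ -(1 / 2) := by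
      simp [ae_iff]
    filter_upwards [hf.fourier_support, h0] with ξ hξ h0
    by_cases h : ξ ∈ Set.Ioc (-(1 / 2) : ℝ) (1 / 2)
    · rw [Set.indicator_of_mem h]
    · rw [Set.indicator_of_notMem h, eq_comm]
      apply hξ
      rw [pi_div_two_pi]
      exact fun hm => h ⟨lt_of_le_of_ne hm.1 (Ne.symm h0), hm.2⟩
  have h2 := bandSynthesis_ae_eq hF
  rw [h, hFdef, FourierTransform.fourierInv_fourier_eq] at h2
  exact (Continuous.ae_eq_iff_eq volume hf.continuous (continuous_bandSynthesis hF)).1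
    (hf.memLp.coeFn_toLp.symm.trans h2)

/-! ### Calculus of `bandSynthesis`: derivatives, shifts, linearity, sup bound. -/

theorem ae_bandMeasure_abs_le : ∀ᵐ ξ ∂bandMeasure, |ξ| ≤ 1 / 2 := by
  rw [bandMeasure]
  filter_upwards [ae_restrict_mem measurableSet_Ioc] with ξ hξ
  exact abs_le.2 ⟨hξ.1.le, hξ.2⟩

theorem memLp_band_mul {c F : ℝ → ℂ} (hF : MemLp F 2 bandMeasure)
    (hc : AEStronglyMeasurable c bandMeasure) (C : ℝ) (hC : ∀ᵐ ξ ∂bandMeasure, ‖c ξ‖ ≤ C) :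
    MemLp (fun ξ => c ξ * F ξ) 2 bandMeasure :=
  hF.mul (memLp_top_of_bound hc C hC)

theorem norm_spectral_exp (x ξ : ℝ) :
    ‖Complex.exp (2 * Real.pi * Complex.I * x * ξ)‖ = 1 := by
  have : 2 * Real.pi * Complex.I * x * ξ = ((2 * Real.pi * x * ξ : ℝ) : ℂ) * Complex.I := by
    push_cast; ring
  rw [this, Complex.norm_exp_ofReal_mul_I]

theorem memLp_spectral_exp_mul {F : ℝ → ℂ} (hF : MemLp F 2 bandMeasure) (x : ℝ) :
    MemLp (fun ξ : ℝ => Complex.exp (2 * Real.pi * Complex.I * x * ξ) * F ξ) 2 bandMeasure :=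
  memLp_band_mul hF (by fun_prop) 1 (.of_forall fun ξ => (norm_spectral_exp x ξ).le)

theorem norm_frequency_le {ξ : ℝ} (hξ : |ξ| ≤ 1 / 2) :
    ‖2 * Real.pi * Complex.I * ξ‖ ≤ Real.pi := by
  simp only [norm_mul, Complex.norm_ofNat, Complex.norm_real, Complex.norm_I, Real.norm_eq_abs,
    abs_of_pos Real.pi_pos]
  nlinarith [Real.pi_pos]

theorem memLp_frequency_pow_mul {F : ℝ → ℂ} (hF : MemLp F 2 bandMeasure) (k : ℕ) :
    MemLp (fun ξ : ℝ => (2 * Real.pi * Complex.I * ξ) ^ k * F ξ) 2 bandMeasure := by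
  refine memLp_band_mul hF (by fun_prop) (Real.pi ^ k) ?_
  filter_upwards [ae_bandMeasure_abs_le] with ξ hξ
  rw [norm_pow]
  exact pow_le_pow_left₀ (norm_nonneg _) (norm_frequency_le hξ) k

theorem integrable_spectral_exp_mul {F : ℝ → ℂ} (hF : MemLp F 2 bandMeasure) (x : ℝ) :
    Integrable (fun ξ : ℝ => Complex.exp (2 * Real.pi * Complex.I * x * ξ) * F ξ) bandMeasure :=
  (memLp_spectral_exp_mul hF x).integrable one_le_two

theorem bandSynthesis_congr {F G : ℝ → ℂ} (h : F =ᵐ[bandMeasure] G) :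
    bandSynthesis F = bandSynthesis G := by
  ext x
  apply integral_congr_ae
  filter_upwards [h] with ξ hξ
  rw [hξ]

theorem hasDerivAt_bandSynthesis {F : ℝ → ℂ} (hF : MemLp F 2 bandMeasure) (x : ℝ) :
    HasDerivAt (bandSynthesis F)
      (bandSynthesis (fun ξ => 2 * Real.pi * Complex.I * ξ * F ξ) x) x := by
  have hF' : MemLp (fun ξ : ℝ => 2 * Real.pi * Complex.I * ξ * F ξ) 2 bandMeasure := by
    simpa using memLp_frequency_pow_mul hF 1
  refine (hasDerivAt_integral_of_dominated_loc_of_deriv_le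
    (F' := fun (x : ℝ) (ξ : ℝ) => Complex.exp (2 * Real.pi * Complex.I * x * ξ) *
      (2 * Real.pi * Complex.I * ξ * F ξ))
    (bound := fun ξ => Real.pi * ‖F ξ‖) (Filter.univ_mem) ?_ ?_ ?_ ?_ ?_ ?_).2
  · exact .of_forall fun y => (memLp_spectral_exp_mul hF y).1
  · exact integrable_spectral_exp_mul hF x
  · exact (memLp_spectral_exp_mul hF' x).1
  · filter_upwards [ae_bandMeasure_abs_le] with ξ hξ y _
    rw [norm_mul, norm_spectral_exp, one_mul, norm_mul]
    exact mul_le_mul_of_nonneg_right (norm_frequency_le hξ) (norm_nonneg _)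
  · exact ((hF.integrable one_le_two).norm).const_mul _
  · refine .of_forall fun ξ y _ => ?_
    have h1 : HasDerivAt (fun y : ℝ => 2 * Real.pi * Complex.I * (y : ℂ) * ξ)
        (2 * Real.pi * Complex.I * ξ) y := by
      have := ((Complex.ofRealCLM.hasDerivAt (x := y)).const_mul
        (2 * Real.pi * Complex.I : ℂ)).mul_const (ξ : ℂ)
      simpa using this
    convert! (h1.cexp.mul_const (F ξ)) using 1
    ring

theorem iteratedDeriv_bandSynthesis {F : ℝ → ℂ} (hF : MemLp F 2 bandMeasure) (k : ℕ) :
    iteratedDeriv k (bandSynthesis F) =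
      bandSynthesis (fun ξ => (2 * Real.pi * Complex.I * ξ) ^ k * F ξ) := by
  induction k with
  | zero => simp
  | succ k ih =>
    ext x
    rw [iteratedDeriv_succ, ih, (hasDerivAt_bandSynthesis (memLp_frequency_pow_mul hF k) x).deriv]
    congr 1
    ext ξ
    ring

theorem contDiff_bandSynthesis {F : ℝ → ℂ} (hF : MemLp F 2 bandMeasure) :
    ContDiff ℝ (⊤ : ℕ∞) (bandSynthesis F) := by
  apply contDiff_of_differentiable_iteratedDeriv
  intro k _
  rw [iteratedDeriv_bandSynthesis hF]
  exact fun x => (hasDerivAt_bandSynthesis (memLp_frequency_pow_mul hF k) x).differentiableAt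

theorem bandSynthesis_comp_sub (F : ℝ → ℂ) (a x : ℝ) :
    bandSynthesis F (x - a) =
      bandSynthesis (fun ξ => Complex.exp (-(2 * Real.pi * Complex.I * a * ξ)) * F ξ) x := by
  rw [bandSynthesis, bandSynthesis]
  congr 1
  ext ξ
  rw [← mul_assoc, ← Complex.exp_add]
  congr 2
  push_cast
  ring

theorem bandSynthesis_add {F G : ℝ → ℂ} (hF : MemLp F 2 bandMeasure) (hG : MemLp G 2 bandMeasure)
    (x : ℝ) : bandSynthesis (fun ξ => F ξ + G ξ) x = bandSynthesis F x + bandSynthesis G x := by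
  rw [bandSynthesis, bandSynthesis, bandSynthesis, ← integral_add
    (integrable_spectral_exp_mul hF x) (integrable_spectral_exp_mul hG x)]
  simp only [mul_add]

theorem bandSynthesis_const_mul (c : ℂ) (F : ℝ → ℂ) (x : ℝ) :
    bandSynthesis (fun ξ => c * F ξ) x = c * bandSynthesis F x := by
  rw [bandSynthesis, bandSynthesis, ← integral_const_mul]
  congr 1
  ext ξ
  ring

theorem bandSynthesis_sub {F G : ℝ → ℂ} (hF : MemLp F 2 bandMeasure) (hG : MemLp G 2 bandMeasure)
    (x : ℝ) : bandSynthesis (fun ξ => F ξ - G ξ) x = bandSynthesis F x - bandSynthesis G x := by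
  rw [bandSynthesis, bandSynthesis, bandSynthesis, ← integral_sub
    (integrable_spectral_exp_mul hF x) (integrable_spectral_exp_mul hG x)]
  simp only [mul_sub]

/-- The band has total mass `1`, so the `L¹` norm is at most the `L²` norm; this is what later makes
`L²` convergence of spectra uniform in `x`. -/
theorem norm_bandSynthesis_le {F : ℝ → ℂ} (hF : MemLp F 2 bandMeasure) (x : ℝ) :
    ‖bandSynthesis F x‖ ≤ (eLpNorm F 2 bandMeasure).toReal := by
  have h1 : ‖bandSynthesis F x‖ ≤ ∫ ξ, ‖F ξ‖ ∂bandMeasure := by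
    refine (norm_integral_le_integral_norm _).trans_eq ?_
    congr 1
    ext ξ
    rw [norm_mul, norm_spectral_exp, one_mul]
  refine h1.trans ?_
  rw [integral_norm_eq_lintegral_enorm hF.1, ← eLpNorm_one_eq_lintegral_enorm]
  exact ENNReal.toReal_mono hF.2.ne (eLpNorm_le_eLpNorm_of_exponent_le one_le_two hF.1)

/-! ### Uniqueness from samples: folding the band and Vandermonde. -/

theorem volume_restrict_Ioc_map_add_right (a b d : ℝ) :
    MeasurePreserving (fun x : ℝ => x + d) (volume.restrict (Set.Ioc a b))
      (volume.restrict (Set.Ioc (a + d) (b + d))) := by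
  have h := (measurePreserving_add_right (volume : Measure ℝ) d).restrict_preimage
    (s := Set.Ioc (a + d) (b + d)) measurableSet_Ioc
  simpa using h

/-- Left endpoint of the `l`-th of the `N` equal subintervals of the band. -/
noncomputable def bandNode (N l : ℕ) : ℝ := -(1 / 2) + l / N

theorem Ioc_bandNode_subset {N l : ℕ} (hl : l < N) :
    Set.Ioc (bandNode N l) (bandNode N (l + 1)) ⊆ Set.Ioc (-(1 / 2)) (1 / 2) := by
  have hN : (0 : ℝ) < N := by exact_mod_cast (Nat.zero_le l).trans_lt hl
  have h1 : ((l : ℝ) + 1) / N ≤ 1 := by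
    rw [div_le_one hN]
    exact_mod_cast hl
  have h2 : (0 : ℝ) ≤ l / N := by positivity
  apply Set.Ioc_subset_Ioc
  · rw [bandNode]; linarith
  · rw [bandNode]; push_cast; linarith

theorem measurePreserving_bandNode (N l : ℕ) :
    MeasurePreserving (fun x : ℝ => x + l / N)
      (volume.restrict (Set.Ioc (bandNode N 0) (bandNode N 1)))
      (volume.restrict (Set.Ioc (bandNode N l) (bandNode N (l + 1)))) := by
  convert! volume_restrict_Ioc_map_add_right (bandNode N 0) (bandNode N 1) (l / N) using 3 <;>
    simp only [bandNode] <;> push_cast <;> ring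

theorem integral_band_eq_sum {N : ℕ} (hN : 1 ≤ N) {H : ℝ → ℂ} (hH : Integrable H bandMeasure) :
    ∫ ξ, H ξ ∂bandMeasure =
      ∫ ξ in bandNode N 0..bandNode N 1, ∑ l ∈ Finset.range N, H (ξ + l / N) := by
  have hN0 : (0 : ℝ) < N := by exact_mod_cast hN
  have hle : ∀ l, bandNode N l ≤ bandNode N (l + 1) := fun l => by
    simp only [bandNode]; push_cast; gcongr; linarith
  have hint : ∀ l < N, IntervalIntegrable H volume (bandNode N l) (bandNode N (l + 1)) := by
    intro l hl
    rw [intervalIntegrable_iff_integrableOn_Ioc_of_le (hle l)]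
    exact IntegrableOn.mono_set hH (Ioc_bandNode_subset hl)
  have h0 : bandNode N 0 = -(1 / 2) := by simp [bandNode]
  have h1 : bandNode N N = 1 / 2 := by
    rw [bandNode, div_self hN0.ne']; norm_num
  rw [intervalIntegral.integral_finsetSum]
  · rw [bandMeasure, ← intervalIntegral.integral_of_le (by norm_num), ← h0, ← h1,
      ← intervalIntegral.sum_integral_adjacent_intervals hint]
    refine Finset.sum_congr rfl fun l _ => ?_
    rw [intervalIntegral.integral_comp_add_right]
    congr 1 <;> simp only [bandNode] <;> push_cast <;> ring
  · intro l hl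
    rw [intervalIntegrable_iff_integrableOn_Ioc_of_le (hle 0)]
    have := hint l (Finset.mem_range.1 hl)
    rw [intervalIntegrable_iff_integrableOn_Ioc_of_le (hle l)] at this
    exact (measurePreserving_bandNode N l).integrable_comp_of_integrable this

/-- Moving by `l/N` changes the phase at the node `N j` by `2πi j l`; this is why sampling on `Nℤ`
sees only the folded spectrum. -/
theorem exp_sample_periodic {N : ℕ} (hN : 1 ≤ N) (j : ℤ) (ξ : ℝ) (l : ℕ) :
    Complex.exp (2 * Real.pi * Complex.I * (N * j : ℝ) * ((ξ + l / N : ℝ) : ℂ)) =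
      Complex.exp (2 * Real.pi * Complex.I * (N * j : ℝ) * (ξ : ℂ)) := by
  have hN0 : (N : ℂ) ≠ 0 := by exact_mod_cast (by omega : N ≠ 0)
  rw [Complex.exp_eq_exp_iff_exists_int]
  refine ⟨j * l, ?_⟩
  push_cast
  field_simp

theorem ae_eq_zero_of_fourierCoeffOn_eq_zero {a b : ℝ} (hab : a < b) {P : ℝ → ℂ}
    (hP : MemLp P 2 (volume.restrict (Set.Ioc a b))) (h : ∀ n, fourierCoeffOn hab P n = 0) :
    P =ᵐ[volume.restrict (Set.Ioc a b)] 0 := by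
  have h1 := tsum_sq_fourierCoeffOn hab hP
  simp only [h, norm_zero, ne_eq, OfNat.ofNat_ne_zero, not_false_eq_true, zero_pow, tsum_zero] at h1
  have h2 : ∫ x in a..b, ‖P x‖ ^ 2 = 0 := by
    have := smul_eq_zero.1 h1.symm
    exact this.resolve_left (inv_ne_zero (sub_pos.2 hab).ne')
  rw [intervalIntegral.integral_of_le hab.le, integral_eq_zero_iff_of_nonneg
    (fun x => by positivity) hP.integrable_norm_pow'] at h2
  filter_upwards [h2] with x hx
  simpa using hx

/-- The factor `N` is the reciprocal length of one subinterval, and the index is `-j` because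
Fourier coefficients carry the opposite sign in the exponent. -/
theorem bandSynthesis_sample {N : ℕ} (hN : 1 ≤ N) {F : ℝ → ℂ} (hF : MemLp F 2 bandMeasure)
    (hab : bandNode N 0 < bandNode N 1) (j : ℤ) :
    fourierCoeffOn hab (fun ξ => ∑ l ∈ Finset.range N, F (ξ + l / N)) (-j) =
      N * bandSynthesis F (N * j) := by
  have hN0 : (N : ℝ) ≠ 0 := by exact_mod_cast (by omega : N ≠ 0)
  have hlen : bandNode N 1 - bandNode N 0 = 1 / N := by simp [bandNode]
  rw [fourierCoeffOn_eq_integral, bandSynthesis,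
    integral_band_eq_sum hN (integrable_spectral_exp_mul hF _)]
  rw [show (1 / (bandNode N 1 - bandNode N 0)) = N by rw [hlen]; field_simp, Complex.real_smul]
  push_cast
  congr 1
  apply intervalIntegral.integral_congr
  intro ξ _
  simp only
  rw [smul_eq_mul, Finset.mul_sum]
  refine Finset.sum_congr rfl fun l _ => ?_
  have := exp_sample_periodic hN j ξ l
  push_cast at this
  rw [neg_neg, fourier_coe_apply, this]
  congr 2
  rw [hlen]
  push_cast
  field_simp

theorem ae_eq_zero_of_samples_eq_zero {N : ℕ} (hN : 1 ≤ N) {F : ℝ → ℂ}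
    (hF : MemLp F 2 bandMeasure)
    (h : ∀ k < N, ∀ j : ℤ, iteratedDeriv k (bandSynthesis F) (N * j) = 0) :
    F =ᵐ[bandMeasure] 0 := by
  have hN0 : (0 : ℝ) < N := by exact_mod_cast hN
  have hab : bandNode N 0 < bandNode N 1 := by
    simp only [bandNode, Nat.cast_zero, zero_div, Nat.cast_one]
    have : 0 < 1 / (N : ℝ) := by positivity
    linarith
  have hk : ∀ k < N, ∀ᵐ ξ ∂(volume.restrict (Set.Ioc (bandNode N 0) (bandNode N 1))),
      ∑ l ∈ Finset.range N,
        (2 * Real.pi * Complex.I * ((ξ + l / N : ℝ) : ℂ)) ^ k * F (ξ + l / N) = 0 := by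
    intro k hk
    have hFk := memLp_frequency_pow_mul hF k
    apply ae_eq_zero_of_fourierCoeffOn_eq_zero hab
    · apply memLp_finsetSum
      intro l hl
      have := hFk.mono_measure (Measure.restrict_mono
        (Ioc_bandNode_subset (Finset.mem_range.1 hl)) le_rfl)
      exact this.comp_measurePreserving (measurePreserving_bandNode N l)
    · intro n
      have := bandSynthesis_sample hN hFk hab (-n)
      rw [neg_neg, ← iteratedDeriv_bandSynthesis hF, h k hk, mul_zero] at this
      exact this
  have hk' : ∀ᵐ ξ ∂(volume.restrict (Set.Ioc (bandNode N 0) (bandNode N 1))),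
      ∀ l < N, F (ξ + l / N) = 0 := by
    have := (ae_ball_iff (Set.to_countable {k : ℕ | k < N})).2 hk
    filter_upwards [this] with ξ hξ l hl
    -- At fixed `ξ` the folded equations for `k < N` form a Vandermonde system in the `N` values `F
    -- (ξ + i/N)`.
    have hv := Matrix.eq_zero_of_forall_pow_sum_mul_pow_eq_zero
      (f := fun i : Fin N => 2 * Real.pi * Complex.I * ((ξ + (i : ℕ) / N : ℝ) : ℂ))
      (v := fun i : Fin N => F (ξ + (i : ℕ) / N)) ?_ ?_
    · exact congrFun hv ⟨l, hl⟩
    · intro i i' hi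
      have h2 := mul_left_cancel₀ Complex.two_pi_I_ne_zero hi
      have h3 : ξ + (i : ℕ) / (N : ℝ) = ξ + (i' : ℕ) / N := by exact_mod_cast h2
      have h4 : ((i : ℕ) : ℝ) = (i' : ℕ) := by
        have := add_left_cancel h3
        field_simp at this
        exact this
      exact Fin.ext (by exact_mod_cast h4)
    · intro i
      rw [← hξ i i.2, Finset.sum_range]
      exact Finset.sum_congr rfl fun _ _ => mul_comm _ _
  have hl : ∀ l < N, ∀ᵐ ξ ∂(volume.restrict (Set.Ioc (bandNode N l) (bandNode N (l + 1)))),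
      F ξ = 0 := by
    intro l hl
    have mp := measurePreserving_bandNode N l
    have hemb : MeasurableEmbedding (fun x : ℝ => x + (l : ℝ) / N) :=
      measurableEmbedding_addRight _
    rw [← mp.map_eq, hemb.ae_map_iff]
    filter_upwards [hk'] with ξ hξ using hξ l hl
  have hcover : Set.Ioc (-(1 / 2) : ℝ) (1 / 2) ⊆
      ⋃ l ∈ Finset.range N, Set.Ioc (bandNode N l) (bandNode N (l + 1)) := by
    intro ξ hξ
    have hpos : 0 < N * (ξ + 1 / 2) := mul_pos hN0 (by linarith [hξ.1])
    -- The subinterval containing `ξ` has index one less than this ceiling, since the intervals are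
    -- closed on the right.
    have hc : 0 < ⌈N * (ξ + 1 / 2)⌉₊ := Nat.ceil_pos.2 hpos
    have hc2 := Nat.le_ceil (N * (ξ + 1 / 2))
    have hc3 := Nat.ceil_lt_add_one hpos.le
    have hc4 : ⌈N * (ξ + 1 / 2)⌉₊ ≤ N := by
      rw [Nat.ceil_le]
      nlinarith [hξ.2]
    obtain ⟨l, hl⟩ := Nat.exists_eq_succ_of_ne_zero hc.ne'
    rw [hl] at hc2 hc3 hc4
    push_cast at hc2 hc3
    simp only [Set.mem_iUnion, Finset.mem_range]
    refine ⟨l, hc4, ?_, ?_⟩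
    · rw [bandNode]
      have : (l : ℝ) / N < ξ + 1 / 2 := by
        rw [div_lt_iff₀ hN0]; linarith
      linarith
    · rw [bandNode]
      push_cast
      have : ξ + 1 / 2 ≤ (l + 1 : ℝ) / N := by
        rw [le_div_iff₀ hN0]; linarith
      linarith
  have hu : ∀ᵐ ξ ∂(volume.restrict
      (⋃ l ∈ Finset.range N, Set.Ioc (bandNode N l) (bandNode N (l + 1)))), F ξ = 0 := by
    rw [ae_restrict_biUnion_finset_iff]
    exact fun l hm => hl l (Finset.mem_range.1 hm)
  exact ae_restrict_of_ae_restrict_of_subset hcover hu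

theorem IsPaleyWiener.eq_of_samples_eq {N : ℕ} (hN : 1 ≤ N) {f g : ℝ → ℂ}
    (hf : IsPaleyWiener Real.pi f) (hg : IsPaleyWiener Real.pi g)
    (h : ∀ k < N, ∀ j : ℤ, iteratedDeriv k f (N * j) = iteratedDeriv k g (N * j)) : f = g := by
  obtain ⟨F, hF, rfl⟩ := hf.exists_bandSynthesis
  obtain ⟨G, hG, rfl⟩ := hg.exists_bandSynthesis
  have hFG : MemLp (fun ξ => F ξ - G ξ) 2 bandMeasure := hF.sub hG
  have h0 := ae_eq_zero_of_samples_eq_zero hN hFG fun k hk j => by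
    rw [iteratedDeriv_bandSynthesis hFG]
    have := bandSynthesis_sub (memLp_frequency_pow_mul hF k) (memLp_frequency_pow_mul hG k)
      (N * j)
    rw [← iteratedDeriv_bandSynthesis hF, ← iteratedDeriv_bandSynthesis hG, h k hk j, sub_self]
      at this
    rw [← this]
    congr 1
    ext ξ
    ring
  apply bandSynthesis_congr
  filter_upwards [h0] with ξ hξ
  exact sub_eq_zero.1 hξ

/-! ### Spectral support of the kernels. -/

/-- `f` is the inverse Fourier transform of a bounded measurable function supported in
`[-a, a]`. -/
def HasBoundedSpectrum (a : ℝ) (f : ℝ → ℂ) : Prop :=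
  ∃ φ : ℝ → ℂ, Measurable φ ∧ (∃ C : ℝ, ∀ ξ, ‖φ ξ‖ ≤ C) ∧ (∀ ξ, a < |ξ| → φ ξ = 0) ∧
    ∀ x : ℝ, f x = ∫ ξ : ℝ, Complex.exp (2 * Real.pi * Complex.I * x * ξ) * φ ξ

theorem integrable_of_bounded_support {a C : ℝ} {φ : ℝ → ℂ} (hm : Measurable φ)
    (hC : ∀ ξ, ‖φ ξ‖ ≤ C) (hs : ∀ ξ, a < |ξ| → φ ξ = 0) : Integrable φ := by
  have h : IntegrableOn φ (Set.Icc (-a) a) := by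
    refine Integrable.of_bound hm.aestronglyMeasurable C (.of_forall hC)
  refine (integrableOn_iff_integrable_of_support_subset ?_).1 h
  intro ξ hξ
  by_contra hn
  apply hξ
  apply hs
  by_contra hle
  exact hn (abs_le.1 (not_lt.1 hle))

theorem integrable_exp_mul {φ : ℝ → ℂ} (h : Integrable φ) (x : ℝ) :
    Integrable fun ξ : ℝ => Complex.exp (2 * Real.pi * Complex.I * x * ξ) * φ ξ :=
  h.bdd_mul (c := 1) (by fun_prop) (.of_forall fun ξ => (norm_spectral_exp x ξ).le)

namespace HasBoundedSpectrum

theorem zero (a : ℝ) : HasBoundedSpectrum a (fun _ => 0) :=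
  ⟨fun _ => 0, measurable_const, ⟨0, by simp⟩, by simp, by simp⟩

theorem add {a : ℝ} {f g : ℝ → ℂ} (hf : HasBoundedSpectrum a f) (hg : HasBoundedSpectrum a g) :
    HasBoundedSpectrum a (fun x => f x + g x) := by
  obtain ⟨φ, hφm, ⟨C, hC⟩, hφs, hφ⟩ := hf
  obtain ⟨ψ, hψm, ⟨D, hD⟩, hψs, hψ⟩ := hg
  refine ⟨fun ξ => φ ξ + ψ ξ, hφm.add hψm,
    ⟨C + D, fun ξ => (norm_add_le _ _).trans (add_le_add (hC ξ) (hD ξ))⟩,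
    fun ξ h => by beta_reduce; rw [hφs ξ h, hψs ξ h, add_zero], fun x => ?_⟩
  beta_reduce
  rw [hφ, hψ, ← integral_add
    (integrable_exp_mul (integrable_of_bounded_support hφm hC hφs) x)
    (integrable_exp_mul (integrable_of_bounded_support hψm hD hψs) x)]
  simp only [mul_add]

theorem const_mul {a : ℝ} {f : ℝ → ℂ} (c : ℂ) (hf : HasBoundedSpectrum a f) :
    HasBoundedSpectrum a (fun x => c * f x) := by
  obtain ⟨φ, hφm, ⟨C, hC⟩, hφs, hφ⟩ := hf
  refine ⟨fun ξ => c * φ ξ, hφm.const_mul c, ⟨‖c‖ * C, fun ξ => ?_⟩,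
    fun ξ h => by beta_reduce; rw [hφs ξ h, mul_zero], fun x => ?_⟩
  · rw [norm_mul]
    exact mul_le_mul_of_nonneg_left (hC ξ) (norm_nonneg c)
  · beta_reduce
    rw [hφ, ← integral_const_mul]
    congr 1
    ext ξ
    ring

theorem finset_sum {ι : Type*} {a : ℝ} {f : ι → ℝ → ℂ} (s : Finset ι)
    (hf : ∀ i ∈ s, HasBoundedSpectrum a (f i)) :
    HasBoundedSpectrum a (fun x => ∑ i ∈ s, f i x) := by
  classical
  induction s using Finset.induction_on with
  | empty => simpa using zero a
  | insert i s hi ih =>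
    simp only [Finset.sum_insert hi]
    exact (hf i (Finset.mem_insert_self i s)).add
      (ih fun j hj => hf j (Finset.mem_insert_of_mem hj))

theorem exp_mul {a : ℝ} {f : ℝ → ℂ} (hf : HasBoundedSpectrum a f) (b : ℝ) :
    HasBoundedSpectrum (a + |b|)
      (fun x => Complex.exp (2 * Real.pi * Complex.I * x * b) * f x) := by
  obtain ⟨φ, hφm, ⟨C, hC⟩, hφs, hφ⟩ := hf
  refine ⟨fun ξ => φ (ξ - b), hφm.comp (measurable_id.sub_const b), ⟨C, fun ξ => hC _⟩,
    fun ξ h => hφs _ ?_, fun x => ?_⟩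
  · have := abs_sub_abs_le_abs_sub ξ b
    linarith
  · beta_reduce
    rw [hφ, ← integral_const_mul, ← integral_sub_right_eq_self _ b]
    congr 1
    ext ξ
    rw [← mul_assoc, ← Complex.exp_add]
    congr 2
    push_cast
    ring

/-- Multiplication in `x` is convolution in frequency: the new density is the integral of `φ` over a
sliding window of length `2b`, and Fubini identifies its transform. -/
theorem mul_box {a b : ℝ} (hb : 0 < b) {f : ℝ → ℂ} (hf : HasBoundedSpectrum a f) :
    HasBoundedSpectrum (a + b) (fun x => f x *
      ∫ η in Set.Icc (-b) b, Complex.exp (2 * Real.pi * Complex.I * x * η)) := by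
  obtain ⟨φ, hφm, ⟨C, hC⟩, hφs, hφ⟩ := hf
  have hφi := integrable_of_bounded_support hφm hC hφs
  have hsm : Measurable fun p : ℝ × ℝ => φ (p.1 - p.2) := hφm.comp measurable_sub
  refine ⟨fun ξ => ∫ η in Set.Icc (-b) b, φ (ξ - η), ?_, ⟨C * (2 * b), fun ξ => ?_⟩,
    fun ξ h => ?_, fun x => ?_⟩
  · exact hsm.stronglyMeasurable.integral_prod_right.measurable
  · refine (norm_setIntegral_le_of_norm_le_const (by simp) (C := C) fun η _ => hC _).trans_eq ?_
    rw [Real.volume_real_Icc_of_le (by linarith)]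
    ring
  · apply setIntegral_eq_zero_of_forall_eq_zero
    intro η hη
    apply hφs
    have := abs_sub_abs_le_abs_sub ξ η
    have := abs_le.2 hη
    linarith
  · have hint : Integrable (Function.uncurry fun ξ η : ℝ =>
        Complex.exp (2 * Real.pi * Complex.I * x * ξ) * φ (ξ - η))
        (volume.prod (volume.restrict (Set.Icc (-b) b))) := by
      have hmeas : Measurable (Function.uncurry fun ξ η : ℝ =>
          Complex.exp (2 * Real.pi * Complex.I * x * ξ) * φ (ξ - η)) := by
        refine Measurable.mul ?_ hsm
        fun_prop
      rw [integrable_prod_iff' hmeas.aestronglyMeasurable]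
      constructor
      · exact .of_forall fun η => integrable_exp_mul (hφi.comp_sub_right η) x
      · have : ∀ η : ℝ, ∫ ξ : ℝ, ‖Function.uncurry (fun ξ η : ℝ =>
          Complex.exp (2 * Real.pi * Complex.I * x * ξ) * φ (ξ - η)) (ξ, η)‖ = ∫ ξ, ‖φ ξ‖ := by
          intro η
          simp only [Function.uncurry_apply_pair, norm_mul, norm_spectral_exp, one_mul]
          exact integral_sub_right_eq_self (fun ξ => ‖φ ξ‖) η
        simp only [this]
        exact integrable_const _
    calc f x * ∫ η in Set.Icc (-b) b, Complex.exp (2 * Real.pi * Complex.I * x * η)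
        = ∫ η in Set.Icc (-b) b, ∫ ξ : ℝ,
            Complex.exp (2 * Real.pi * Complex.I * x * ξ) * φ (ξ - η) := by
          rw [mul_comm, ← integral_mul_const]
          congr 1
          ext η
          rw [hφ, ← integral_const_mul, ← integral_sub_right_eq_self _ η]
          congr 1
          ext ξ
          rw [← mul_assoc, ← Complex.exp_add]
          congr 2
          push_cast
          ring
      _ = ∫ ξ : ℝ, ∫ η in Set.Icc (-b) b,
            Complex.exp (2 * Real.pi * Complex.I * x * ξ) * φ (ξ - η) :=
          (integral_integral_swap hint).symm
      _ = _ := by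
          congr 1
          ext ξ
          rw [integral_const_mul]

theorem box {b : ℝ} : HasBoundedSpectrum b (fun x =>
      ∫ η in Set.Icc (-b) b, Complex.exp (2 * Real.pi * Complex.I * x * η)) := by
  refine ⟨(Set.Icc (-b) b).indicator fun _ => 1, measurable_const.indicator measurableSet_Icc,
    ⟨1, fun ξ => (norm_indicator_le_norm_self _ _).trans (by simp)⟩, fun ξ h => ?_, fun x => ?_⟩
  · apply Set.indicator_of_notMem
    exact fun hm => (not_lt.2 (abs_le.2 hm)) h
  · beta_reduce
    rw [← integral_indicator measurableSet_Icc]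
    congr 1
    ext ξ
    by_cases h : ξ ∈ Set.Icc (-b) b <;> simp [h]

theorem exists_eq_bandSynthesis {f : ℝ → ℂ} (hf : HasBoundedSpectrum (1 / 2) f) :
    ∃ φ : ℝ → ℂ, Measurable φ ∧ (∃ C : ℝ, ∀ ξ, ‖φ ξ‖ ≤ C) ∧ f = bandSynthesis φ := by
  obtain ⟨φ, hφm, hC, hφs, hφ⟩ := hf
  refine ⟨φ, hφm, hC, ?_⟩
  ext x
  rw [hφ, bandSynthesis, bandMeasure, ← integral_Icc_eq_integral_Ioc, eq_comm]
  apply setIntegral_eq_integral_of_forall_compl_eq_zero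
  intro ξ hξ
  rw [hφs ξ, mul_zero]
  by_contra h
  exact hξ (abs_le.1 (not_lt.1 h))

end HasBoundedSpectrum

theorem integral_exp_Icc_eq_cardSinc {N : ℕ} (hN : 1 ≤ N) (x : ℝ) :
    ∫ η in Set.Icc (-(1 / (2 * N) : ℝ)) (1 / (2 * N)),
      Complex.exp (2 * Real.pi * Complex.I * x * η) = (1 / N : ℂ) * cardSinc (x / N) := by
  have hN0 : (0 : ℝ) < N := by exact_mod_cast hN
  have hNc : (N : ℂ) ≠ 0 := by exact_mod_cast hN0.ne'
  have hpos : (0 : ℝ) < 1 / (2 * N) := by positivity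
  rw [integral_Icc_eq_integral_Ioc, ← intervalIntegral.integral_of_le (by linarith)]
  rcases eq_or_ne x 0 with rfl | hx
  · simp [cardSinc]
    field_simp
    norm_num
  · have hxc : (x : ℂ) ≠ 0 := by exact_mod_cast hx
    have hpi : (Real.pi : ℂ) ≠ 0 := by exact_mod_cast Real.pi_ne_zero
    rw [integral_exp_mul_complex
      (mul_ne_zero (mul_ne_zero (mul_ne_zero two_ne_zero hpi) Complex.I_ne_zero) hxc),
      cardSinc, Real.sinc_of_ne_zero (by have := Real.pi_ne_zero; positivity)]
    push_cast
    rw [Complex.sin]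
    have e1 : 2 * Real.pi * Complex.I * x * (1 / (2 * N)) = Real.pi * (x / N) * Complex.I := by
      field_simp
    have e2 : 2 * Real.pi * Complex.I * x * -(1 / (2 * N)) = -(Real.pi * (x / N)) * Complex.I := by
      field_simp
    rw [e1, e2]
    field_simp
    ring_nf
    rw [Complex.I_sq]
    ring

theorem hasBoundedSpectrum_cardSinc_pow {N : ℕ} (hN : 1 ≤ N) (q : ℕ) :
    HasBoundedSpectrum ((q + 1 : ℕ) * (1 / (2 * N)))
      (fun x => (cardSinc (x / N) : ℂ) ^ (q + 1)) := by
  have hN0 : (0 : ℝ) < N := by exact_mod_cast hN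
  have hNc : (N : ℂ) ≠ 0 := by exact_mod_cast hN0.ne'
  have hpos : (0 : ℝ) < 1 / (2 * N) := by positivity
  induction q with
  | zero =>
    have := (HasBoundedSpectrum.box (b := 1 / (2 * N))).const_mul N
    simp only [integral_exp_Icc_eq_cardSinc hN] at this
    convert! this using 1
    · simp
    · ext x
      field_simp
      ring
  | succ q ih =>
    have := (ih.mul_box hpos).const_mul N
    simp only [integral_exp_Icc_eq_cardSinc hN] at this
    convert! this using 1
    · push_cast
      ring
    · ext x
      field_simp
      ring

/-- The factor `x` cancels the denominator of `sinc`, leaving a sine, that is, the two frequencies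
`±1/(2N)`. So `x * sinc (x/N)` costs the same bandwidth as `sinc (x/N)`. -/
theorem mul_cardSinc_eq {N : ℕ} (hN : 1 ≤ N) (x : ℝ) :
    (x : ℂ) * cardSinc (x / N) = N / (2 * Real.pi * Complex.I) *
      (Complex.exp (2 * Real.pi * Complex.I * x * (1 / (2 * N) : ℝ)) -
        Complex.exp (2 * Real.pi * Complex.I * x * (-(1 / (2 * N)) : ℝ))) := by
  have hN0 : (0 : ℝ) < N := by exact_mod_cast hN
  have hNc : (N : ℂ) ≠ 0 := by exact_mod_cast hN0.ne'
  have hpi : (Real.pi : ℂ) ≠ 0 := by exact_mod_cast Real.pi_ne_zero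
  rcases eq_or_ne x 0 with rfl | hx
  · simp
  · have hxc : (x : ℂ) ≠ 0 := by exact_mod_cast hx
    rw [cardSinc, Real.sinc_of_ne_zero (by have := Real.pi_ne_zero; positivity)]
    push_cast
    rw [Complex.sin]
    have e1 : 2 * Real.pi * Complex.I * x * (1 / (2 * N)) = Real.pi * (x / N) * Complex.I := by
      field_simp
    have e2 : 2 * Real.pi * Complex.I * x * -(1 / (2 * N)) = -(Real.pi * (x / N)) * Complex.I := by
      field_simp
    rw [e1, e2]
    field_simp
    ring_nf
    rw [Complex.I_sq]
    ring

/-- At least one `sinc` factor must stay unpaired with an `x`, hence the `+ 1`: a product of pairs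
alone is a trigonometric polynomial, which has no spectral density. -/
theorem hasBoundedSpectrum_pow_mul_cardSinc_pow {N : ℕ} (hN : 1 ≤ N) (p q : ℕ) :
    HasBoundedSpectrum ((p + q + 1 : ℕ) * (1 / (2 * N)))
      (fun x => (x : ℂ) ^ p * (cardSinc (x / N) : ℂ) ^ (p + q + 1)) := by
  have hN0 : (0 : ℝ) < N := by exact_mod_cast hN
  have hpos : (0 : ℝ) < 1 / (2 * N) := by positivity
  induction p with
  | zero => simpa using hasBoundedSpectrum_cardSinc_pow hN q
  | succ p ih =>
    have h1 := ih.exp_mul (1 / (2 * N))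
    have h2 := (ih.exp_mul (-(1 / (2 * N)))).const_mul (-1)
    rw [abs_neg] at h2
    have h3 := (h1.add h2).const_mul (N / (2 * Real.pi * Complex.I))
    convert! h3 using 1
    · rw [abs_of_pos hpos]
      push_cast
      ring
    · ext x
      rw [show (x : ℂ) ^ (p + 1) * (cardSinc (x / N) : ℂ) ^ (p + 1 + q + 1) =
        (x * cardSinc (x / N)) * (x ^ p * cardSinc (x / N) ^ (p + q + 1)) by ring,
        mul_cardSinc_eq hN]
      ring

theorem hasBoundedSpectrum_derivKernel {N n : ℕ} (hN : 1 ≤ N) (hn : n ∈ Finset.Icc 1 N) :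
    HasBoundedSpectrum (1 / 2) (derivKernel N n) := by
  have hN0 : (0 : ℝ) < N := by exact_mod_cast hN
  rw [Finset.mem_Icc] at hn
  have key : derivKernel N n = fun x : ℝ => ∑ m ∈ Finset.Icc n N,
      (nodeCoeff N m * ((Nat.factorial (m - 1) : ℂ) / (Nat.factorial (N - 1) : ℂ)) /
        (Nat.factorial (n - 1) : ℂ)) *
        ((x : ℂ) ^ (N - m + (n - 1)) * (cardSinc (x / N) : ℂ) ^ N) := by
    ext x
    rw [derivKernel, Finset.sum_mul, Finset.sum_mul]
    refine Finset.sum_congr rfl fun m _ => ?_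
    rw [pow_add]
    ring
  rw [key]
  apply HasBoundedSpectrum.finset_sum
  intro m hm
  rw [Finset.mem_Icc] at hm
  apply HasBoundedSpectrum.const_mul
  -- Since `n ≤ m`, the total power of `x` is at most `N - 1`, leaving `m - n + 1` unpaired factors.
  have := hasBoundedSpectrum_pow_mul_cardSinc_pow hN (N - m + (n - 1)) (m - n)
  rw [show N - m + (n - 1) + (m - n) + 1 = N by omega] at this
  convert! this using 1
  field_simp

theorem contDiff_cardSinc_div {N : ℕ} (hN : 1 ≤ N) :
    ContDiff ℝ (⊤ : ℕ∞) (fun x : ℝ => (cardSinc (x / N) : ℂ)) := by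
  have hN0 : (0 : ℝ) < N := by exact_mod_cast hN
  have h : HasBoundedSpectrum (1 / 2) (fun x : ℝ => (cardSinc (x / N) : ℂ)) := by
    obtain ⟨φ, hφm, hC, hφs, hφ⟩ := hasBoundedSpectrum_cardSinc_pow hN 0
    refine ⟨φ, hφm, hC, fun ξ hξ => hφs ξ (lt_of_le_of_lt ?_ hξ), fun x => by simpa using hφ x⟩
    have : (1 : ℝ) ≤ N := by exact_mod_cast hN
    rw [zero_add, Nat.cast_one, one_mul]
    exact one_div_le_one_div_of_le two_pos (by linarith)
  obtain ⟨φ, hφm, ⟨C, hC⟩, hφ⟩ := h.exists_eq_bandSynthesis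
  rw [hφ]
  exact contDiff_bandSynthesis (MemLp.of_bound hφm.aestronglyMeasurable C (.of_forall hC))

/-! ### Generating function of the node coefficients. -/

/-- The power series of `e^{a X}`. -/
noncomputable def expSeries (a : ℂ) : PowerSeries ℂ :=
  PowerSeries.mk fun n => a ^ n / (Nat.factorial n : ℂ)

theorem expSeries_eq_rescale (a : ℂ) :
    expSeries a = PowerSeries.rescale a (PowerSeries.exp ℂ) := by
  ext n
  simp [expSeries, PowerSeries.coeff_rescale, PowerSeries.coeff_exp, div_eq_mul_inv]

theorem expSeries_mul (a b : ℂ) : expSeries a * expSeries b = expSeries (a + b) := by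
  simp only [expSeries_eq_rescale]
  exact PowerSeries.exp_mul_exp_eq_exp_add a b

theorem expSeries_zero : expSeries 0 = 1 := by
  rw [expSeries_eq_rescale]
  simp

theorem expSeries_pow (a : ℂ) (n : ℕ) : expSeries a ^ n = expSeries (n * a) := by
  induction n with
  | zero => simp [expSeries_zero]
  | succ n ih =>
    rw [pow_succ, ih, expSeries_mul]
    congr 1
    push_cast
    ring

theorem derivative_expSeries (a : ℂ) :
    PowerSeries.derivative ℂ (expSeries a) = PowerSeries.C a * expSeries a := by
  ext n
  have h : ((n : ℂ) + 1) ≠ 0 := by exact_mod_cast Nat.succ_ne_zero n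
  have h' : (Nat.factorial n : ℂ) ≠ 0 := by exact_mod_cast Nat.factorial_ne_zero n
  rw [PowerSeries.coeff_derivative, PowerSeries.coeff_C_mul, expSeries, PowerSeries.coeff_mk,
    PowerSeries.coeff_mk, Nat.factorial_succ]
  push_cast
  field_simp
  ring

/-- Differentiating `hE` and eliminating the exponential difference gives a Riccati-type equation,
which relates consecutive powers of `E`. -/
theorem X_mul_derivative_eq_sub {w : ℂ} (hw : w ≠ 0) {E : PowerSeries ℂ}
    (hE : E * (expSeries w - 1) = PowerSeries.C w * PowerSeries.X) :
    PowerSeries.X * PowerSeries.derivative ℂ E = E - E ^ 2 * expSeries w := by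
  have h := congrArg (PowerSeries.derivative ℂ) hE
  rw [Derivation.leibniz, Derivation.leibniz, map_sub, derivative_expSeries,
    PowerSeries.derivative_X, PowerSeries.derivative_C, Derivation.map_one_eq_zero] at h
  simp only [smul_eq_mul, sub_zero, mul_zero, add_zero, mul_one] at h
  have hC : (PowerSeries.C w : PowerSeries ℂ) ≠ 0 := by
    intro h0
    exact hw (PowerSeries.C_injective (by rw [h0, map_zero]))
  apply mul_left_cancel₀ hC
  linear_combination E * h - PowerSeries.derivative ℂ E * hE

/-- The Nørlund polynomial identity `B_N^{(N+1)}(y) = (y - 1) ⋯ (y - N)`, with step `w`. -/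
theorem coeff_pow_mul_expSeries {w : ℂ} (hw : w ≠ 0) {E : PowerSeries ℂ}
    (hE : E * (expSeries w - 1) = PowerSeries.C w * PowerSeries.X) (N : ℕ) (y : ℂ) :
    PowerSeries.coeff N (E ^ (N + 1) * expSeries y) =
      (∏ j ∈ Finset.range N, (y - (j + 1) * w)) / (Nat.factorial N : ℂ) := by
  induction N generalizing y with
  | zero =>
    have h1 := congrArg (PowerSeries.coeff 1) hE
    rw [PowerSeries.coeff_C_mul, PowerSeries.coeff_one_X, PowerSeries.coeff_mul] at h1
    simp [Finset.Nat.antidiagonal_succ, expSeries, PowerSeries.coeff_one] at h1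
    have h2 : PowerSeries.constantCoeff E = 1 :=
      mul_right_cancel₀ hw (h1.trans (one_mul w).symm)
    simp [h2, expSeries]
  | succ N ih =>
    have hX := X_mul_derivative_eq_sub hw hE
    have hder : PowerSeries.X * PowerSeries.derivative ℂ (E ^ (N + 1) * expSeries (y - w)) =
        PowerSeries.C (N + 1 : ℂ) * (E ^ (N + 1) * expSeries (y - w)) -
          PowerSeries.C (N + 1 : ℂ) * (E ^ (N + 2) * expSeries y) +
          PowerSeries.C (y - w) * (PowerSeries.X * (E ^ (N + 1) * expSeries (y - w))) := by
      have hy : expSeries y = expSeries w * expSeries (y - w) := by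
        rw [expSeries_mul, add_sub_cancel]
      rw [Derivation.leibniz, Derivation.leibniz_pow, derivative_expSeries, hy]
      simp only [smul_eq_mul, nsmul_eq_mul, Nat.add_sub_cancel, map_add, map_one, map_natCast]
      push_cast
      linear_combination (expSeries (y - w) * (N + 1) * E ^ N) * hX
    -- In this degree `X * d/dX` multiplies by `N + 1`, so the terms with `E ^ (N + 1)` in degree `N
    -- + 1` cancel. What remains expresses the coefficient for `E ^ (N + 2)` through the induction
    -- hypothesis at `y - w`.
    have hc := congrArg (PowerSeries.coeff (N + 1)) hder
    rw [map_add, map_sub, PowerSeries.coeff_C_mul, PowerSeries.coeff_C_mul,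
      PowerSeries.coeff_C_mul, PowerSeries.coeff_succ_X_mul, PowerSeries.coeff_succ_X_mul,
      PowerSeries.coeff_derivative, ih] at hc
    have hN : ((N : ℂ) + 1) ≠ 0 := by exact_mod_cast Nat.succ_ne_zero N
    have hf : (Nat.factorial N : ℂ) ≠ 0 := by exact_mod_cast Nat.factorial_ne_zero N
    have hprod : ∏ j ∈ Finset.range (N + 1), (y - ((j : ℂ) + 1) * w) =
        (∏ j ∈ Finset.range N, (y - w - ((j : ℂ) + 1) * w)) * (y - w) := by
      rw [Finset.prod_range_succ']
      congr 1
      · refine Finset.prod_congr rfl fun j _ => ?_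
        push_cast
        ring
      · simp
    rw [hprod, Nat.factorial_succ]
    push_cast
    generalize ∏ j ∈ Finset.range N, (y - w - ((j : ℂ) + 1) * w) = P at hc ⊢
    rw [eq_div_iff (mul_ne_zero hN hf)]
    field_simp at hc
    linear_combination hc

/-- Multiplying `V` by `e^{-πiX/N}` turns the symmetric difference into `e^{wX} - 1` with `w =
2πi/N`; over `N` factors this shifts `y` by `πi`, as in `nodePoly`. -/
theorem coeff_symm_pow_mul_expSeries {N : ℕ} (hN : 1 ≤ N) {V : PowerSeries ℂ}
    (hV : V * (expSeries (Real.pi * Complex.I / N) - expSeries (-(Real.pi * Complex.I / N))) =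
      PowerSeries.C (2 * Real.pi * Complex.I / N) * PowerSeries.X) (y : ℂ) :
    PowerSeries.coeff (N - 1) (V ^ N * expSeries y) =
      (nodePoly N).eval y / (Nat.factorial (N - 1) : ℂ) := by
  have hNc : (N : ℂ) ≠ 0 := by exact_mod_cast (by omega : N ≠ 0)
  set h : ℂ := Real.pi * Complex.I / N with hh
  have hw : (2 * Real.pi * Complex.I / N : ℂ) ≠ 0 := div_ne_zero Complex.two_pi_I_ne_zero hNc
  have hw2 : (2 * Real.pi * Complex.I / N : ℂ) = h + h := by rw [hh]; ring
  have hE : (V * expSeries (-h)) * (expSeries (2 * Real.pi * Complex.I / N) - 1) =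
      PowerSeries.C (2 * Real.pi * Complex.I / N) * PowerSeries.X := by
    rw [← hV, hw2, mul_assoc, mul_sub, expSeries_mul, mul_one, neg_add_cancel_left]
  have hVE : V ^ N * expSeries y =
      (V * expSeries (-h)) ^ (N - 1 + 1) * expSeries (y + Real.pi * Complex.I) := by
    rw [Nat.sub_add_cancel hN, mul_pow, expSeries_pow, mul_assoc, expSeries_mul]
    congr 2
    rw [hh]
    field_simp
    ring
  rw [hVE, coeff_pow_mul_expSeries hw hE, nodePoly, Polynomial.eval_prod]
  congr 1
  have hI : Finset.Icc 1 (N - 1) = Finset.Ico 1 N := by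
    ext j
    rw [Finset.mem_Icc, Finset.mem_Ico]
    omega
  rw [hI, Finset.prod_Ico_eq_prod_range]
  refine Finset.prod_congr rfl fun j _ => ?_
  rw [Polynomial.eval_add, Polynomial.eval_X, Polynomial.eval_C]
  push_cast
  ring

/-- Both sides of the previous identity are polynomials in `y`; the coefficient of `y^(m-1)`
isolates a single coefficient of `V ^ N`. -/
theorem coeff_pow_eq_nodeCoeff {N : ℕ} (hN : 1 ≤ N) {V : PowerSeries ℂ}
    (hV : V * (expSeries (Real.pi * Complex.I / N) - expSeries (-(Real.pi * Complex.I / N))) =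
      PowerSeries.C (2 * Real.pi * Complex.I / N) * PowerSeries.X) {m : ℕ}
    (hm : m ∈ Finset.Icc 1 N) :
    PowerSeries.coeff (N - m) (V ^ N) =
      nodeCoeff N m * ((Nat.factorial (m - 1) : ℂ) / (Nat.factorial (N - 1) : ℂ)) := by
  rw [Finset.mem_Icc] at hm
  have hpoly : ∑ p ∈ Finset.HasAntidiagonal.antidiagonal (N - 1),
      Polynomial.monomial p.2 (PowerSeries.coeff p.1 (V ^ N) / (Nat.factorial p.2 : ℂ)) =
      nodePoly N * Polynomial.C (1 / (Nat.factorial (N - 1) : ℂ)) := by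
    apply Polynomial.funext
    intro y
    have h := coeff_symm_pow_mul_expSeries hN hV y
    rw [PowerSeries.coeff_mul] at h
    rw [Polynomial.eval_mul, Polynomial.eval_C, mul_one_div, ← h, Polynomial.eval_finsetSum]
    refine Finset.sum_congr rfl fun p _ => ?_
    rw [Polynomial.eval_monomial, expSeries, PowerSeries.coeff_mk]
    ring
  have hc := congrArg (fun p => Polynomial.coeff p (m - 1)) hpoly
  simp only [Polynomial.finsetSum_coeff, Polynomial.coeff_monomial, Polynomial.coeff_mul_C] at hc
  rw [Finset.sum_eq_single (N - m, m - 1)] at hc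
  · have hf : (Nat.factorial (m - 1) : ℂ) ≠ 0 := by exact_mod_cast Nat.factorial_ne_zero _
    simp only [if_true] at hc
    rw [nodeCoeff, (div_eq_iff hf).1 hc]
    ring
  · intro p hp hne
    rw [if_neg]
    intro h2
    apply hne
    rw [Finset.HasAntidiagonal.mem_antidiagonal] at hp
    ext
    · simp only; omega
    · exact h2
  · intro hn
    exfalso
    apply hn
    rw [Finset.HasAntidiagonal.mem_antidiagonal]
    simp only
    omega

/-! ### Taylor expansions and the sampled data of the kernels. -/

/-- The Taylor series of `f` at `a`. -/
noncomputable def taylorAt (a : ℝ) (f : ℝ → ℂ) : PowerSeries ℂ :=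
  PowerSeries.mk fun k => iteratedDeriv k f a / (Nat.factorial k : ℂ)

theorem taylorAt_mul {f g : ℝ → ℂ} (hf : ContDiff ℝ (⊤ : ℕ∞) f) (hg : ContDiff ℝ (⊤ : ℕ∞) g)
    (a : ℝ) : taylorAt a (fun x => f x * g x) = taylorAt a f * taylorAt a g := by
  ext n
  rw [PowerSeries.coeff_mul, taylorAt, PowerSeries.coeff_mk]
  have h := iteratedDeriv_mul (n := n) (x := a)
    (hf.contDiffAt.of_le (by exact_mod_cast le_top)) (hg.contDiffAt.of_le (by exact_mod_cast le_top))
  rw [show (fun x => f x * g x) = f * g from rfl, h,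
    Finset.Nat.sum_antidiagonal_eq_sum_range_succ
      (fun i j => PowerSeries.coeff i (taylorAt a f) * PowerSeries.coeff j (taylorAt a g)),
    Finset.sum_div]
  refine Finset.sum_congr rfl fun i hi => ?_
  have hi' : i ≤ n := Nat.lt_succ_iff.1 (Finset.mem_range.1 hi)
  rw [taylorAt, taylorAt, PowerSeries.coeff_mk, PowerSeries.coeff_mk, Nat.cast_choose ℂ hi']
  have h1 : (Nat.factorial n : ℂ) ≠ 0 := by exact_mod_cast Nat.factorial_ne_zero _
  field_simp

theorem taylorAt_const (a : ℝ) (c : ℂ) : taylorAt a (fun _ => c) = PowerSeries.C c := by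
  ext n
  rw [taylorAt, PowerSeries.coeff_mk, PowerSeries.coeff_C, iteratedDeriv_const]
  split_ifs with h <;> simp [h]

theorem taylorAt_add {f g : ℝ → ℂ} (hf : ContDiff ℝ (⊤ : ℕ∞) f) (hg : ContDiff ℝ (⊤ : ℕ∞) g)
    (a : ℝ) : taylorAt a (fun x => f x + g x) = taylorAt a f + taylorAt a g := by
  ext n
  rw [map_add, taylorAt, taylorAt, taylorAt, PowerSeries.coeff_mk, PowerSeries.coeff_mk,
    PowerSeries.coeff_mk, iteratedDeriv_fun_add
    (hf.contDiffAt.of_le (by exact_mod_cast le_top)) (hg.contDiffAt.of_le (by exact_mod_cast le_top)),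
    add_div]

theorem taylorAt_finset_sum {ι : Type*} (s : Finset ι) {f : ι → ℝ → ℂ}
    (hf : ∀ i ∈ s, ContDiff ℝ (⊤ : ℕ∞) (f i)) (a : ℝ) :
    taylorAt a (fun x => ∑ i ∈ s, f i x) = ∑ i ∈ s, taylorAt a (f i) := by
  classical
  induction s using Finset.induction_on with
  | empty => simpa using taylorAt_const a 0
  | insert i s hi ih =>
    simp only [Finset.sum_insert hi]
    rw [taylorAt_add (hf i (Finset.mem_insert_self i s))
      (ContDiff.sum fun j hj => hf j (Finset.mem_insert_of_mem hj)),
      ih fun j hj => hf j (Finset.mem_insert_of_mem hj)]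

theorem taylorAt_pow {f : ℝ → ℂ} (hf : ContDiff ℝ (⊤ : ℕ∞) f) (a : ℝ) (n : ℕ) :
    taylorAt a (fun x => f x ^ n) = taylorAt a f ^ n := by
  induction n with
  | zero => simpa using taylorAt_const a 1
  | succ n ih =>
    simp only [pow_succ]
    rw [taylorAt_mul (hf.pow n) hf, ih]

theorem taylorAt_zero_ofReal : taylorAt 0 (fun x => (x : ℂ)) = PowerSeries.X := by
  have h1 : deriv (fun x : ℝ => (x : ℂ)) = fun _ => 1 := by
    ext x
    exact (Complex.ofRealCLM.hasDerivAt (x := x)).deriv.trans (by simp)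
  ext n
  rw [taylorAt, PowerSeries.coeff_mk, PowerSeries.coeff_X]
  rcases n with _ | n
  · simp
  · rw [iteratedDeriv_succ', h1, iteratedDeriv_const]
    rcases n with _ | n <;> simp

theorem iteratedDeriv_cexp_mul_ofReal (c : ℂ) (n : ℕ) :
    iteratedDeriv n (fun x : ℝ => Complex.exp (c * x)) =
      fun x : ℝ => c ^ n * Complex.exp (c * x) := by
  induction n with
  | zero => simp
  | succ n ih =>
    rw [iteratedDeriv_succ, ih]
    ext x
    have h1 : HasDerivAt (fun x : ℝ => c * (x : ℂ)) c x := by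
      simpa using (Complex.ofRealCLM.hasDerivAt (x := x)).const_mul c
    rw [(h1.cexp.const_mul (c ^ n)).deriv]
    ring

theorem taylorAt_zero_exp (c : ℂ) :
    taylorAt 0 (fun x : ℝ => Complex.exp (c * x)) = expSeries c := by
  ext n
  rw [taylorAt, PowerSeries.coeff_mk, iteratedDeriv_cexp_mul_ofReal, expSeries,
    PowerSeries.coeff_mk]
  simp

theorem contDiff_complex_ofReal : ContDiff ℝ (⊤ : ℕ∞) (fun x : ℝ => (x : ℂ)) :=
  Complex.ofRealCLM.contDiff

/-- The Taylor polynomial of the inverse of `sinc (x / N) ^ N` that enters `derivKernel`. -/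
noncomputable def kernelSeries (N n : ℕ) : PowerSeries ℂ :=
  ∑ m ∈ Finset.Icc n N,
    PowerSeries.C (nodeCoeff N m * ((Nat.factorial (m - 1) : ℂ) / (Nat.factorial (N - 1) : ℂ))) *
      PowerSeries.X ^ (N - m)

theorem taylorAt_derivKernel {N : ℕ} (hN : 1 ≤ N) (n : ℕ) (a : ℝ) :
    ∃ U : PowerSeries ℂ, taylorAt a (derivKernel N n) =
      U * taylorAt a (fun x : ℝ => (cardSinc (x / N) : ℂ)) ^ N ∧
      (a = 0 → U = kernelSeries N n *
        (PowerSeries.X ^ (n - 1) * PowerSeries.C (1 / (Nat.factorial (n - 1) : ℂ)))) := by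
  have hs := contDiff_cardSinc_div hN
  have hx := contDiff_complex_ofReal
  have h1 : ∀ m ∈ Finset.Icc n N, ContDiff ℝ (⊤ : ℕ∞) (fun x : ℝ =>
      nodeCoeff N m * ((Nat.factorial (m - 1) : ℂ) / (Nat.factorial (N - 1) : ℂ)) *
        (x : ℂ) ^ (N - m)) := fun m _ => contDiff_const.mul (hx.pow _)
  have h2 : ContDiff ℝ (⊤ : ℕ∞) (fun x : ℝ => (x : ℂ) ^ (n - 1) *
      (1 / (Nat.factorial (n - 1) : ℂ))) := (hx.pow _).mul contDiff_const
  have e : derivKernel N n = fun x : ℝ => (∑ m ∈ Finset.Icc n N,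
      nodeCoeff N m * ((Nat.factorial (m - 1) : ℂ) / (Nat.factorial (N - 1) : ℂ)) *
        (x : ℂ) ^ (N - m)) * ((x : ℂ) ^ (n - 1) * (1 / (Nat.factorial (n - 1) : ℂ))) *
        (cardSinc (x / N) : ℂ) ^ N := by
    ext x
    rw [derivKernel, mul_one_div]
  refine ⟨taylorAt a (fun x : ℝ => (∑ m ∈ Finset.Icc n N,
      nodeCoeff N m * ((Nat.factorial (m - 1) : ℂ) / (Nat.factorial (N - 1) : ℂ)) *
        (x : ℂ) ^ (N - m)) * ((x : ℂ) ^ (n - 1) * (1 / (Nat.factorial (n - 1) : ℂ)))), ?_, ?_⟩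
  · rw [e, taylorAt_mul ((ContDiff.sum h1).mul h2) (hs.pow N), taylorAt_pow hs]
  · rintro rfl
    rw [taylorAt_mul (ContDiff.sum h1) h2, taylorAt_mul (hx.pow _) contDiff_const,
      taylorAt_const, taylorAt_pow hx, taylorAt_zero_ofReal, taylorAt_finset_sum _ h1,
      kernelSeries]
    congr 1
    refine Finset.sum_congr rfl fun m _ => ?_
    rw [taylorAt_mul contDiff_const (hx.pow _), taylorAt_const, taylorAt_pow hx,
      taylorAt_zero_ofReal]

theorem iteratedDeriv_eq_coeff_taylorAt (f : ℝ → ℂ) (a : ℝ) (k : ℕ) :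
    iteratedDeriv k f a = PowerSeries.coeff k (taylorAt a f) * (Nat.factorial k : ℂ) := by
  have h1 : (Nat.factorial k : ℂ) ≠ 0 := by exact_mod_cast Nat.factorial_ne_zero _
  rw [taylorAt, PowerSeries.coeff_mk, div_mul_cancel₀ _ h1]

theorem cardSinc_sample {N : ℕ} (hN : 1 ≤ N) {j : ℤ} (hj : j ≠ 0) :
    cardSinc (N * j / N) = 0 := by
  have hN0 : (N : ℝ) ≠ 0 := by exact_mod_cast (by omega : N ≠ 0)
  have hj0 : (j : ℝ) ≠ 0 := by exact_mod_cast hj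
  rw [mul_div_cancel_left₀ _ hN0, cardSinc, Real.sinc_of_ne_zero (mul_ne_zero Real.pi_ne_zero hj0),
    mul_comm, Real.sin_int_mul_pi, zero_div]

theorem iteratedDeriv_derivKernel_ne {N : ℕ} (hN : 1 ≤ N) (n : ℕ) {j : ℤ} (hj : j ≠ 0) {k : ℕ}
    (hk : k < N) : iteratedDeriv k (derivKernel N n) (N * j) = 0 := by
  obtain ⟨U, hU, -⟩ := taylorAt_derivKernel hN n (N * j)
  have h0 : PowerSeries.X ∣ taylorAt (N * j) (fun x : ℝ => (cardSinc (x / N) : ℂ)) := by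
    rw [PowerSeries.X_dvd_iff, ← PowerSeries.coeff_zero_eq_constantCoeff_apply, taylorAt,
      PowerSeries.coeff_mk, iteratedDeriv_zero, cardSinc_sample hN hj]
    simp
  have h1 : PowerSeries.X ^ N ∣ taylorAt (N * j) (derivKernel N n) := by
    rw [hU]
    exact (pow_dvd_pow_of_dvd h0 N).mul_left U
  rw [iteratedDeriv_eq_coeff_taylorAt, PowerSeries.X_pow_dvd_iff.1 h1 k hk, zero_mul]

theorem taylorAt_zero_cardSinc_mul {N : ℕ} (hN : 1 ≤ N) :
    PowerSeries.C (2 * Real.pi * Complex.I / N) *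
      (PowerSeries.X * taylorAt 0 (fun x : ℝ => (cardSinc (x / N) : ℂ))) =
    expSeries (Real.pi * Complex.I / N) - expSeries (-(Real.pi * Complex.I / N)) := by
  have hNc : (N : ℂ) ≠ 0 := by exact_mod_cast (by omega : N ≠ 0)
  have hs := contDiff_cardSinc_div hN
  have hx := contDiff_complex_ofReal
  have hexp : ∀ c : ℂ, ContDiff ℝ (⊤ : ℕ∞) (fun x : ℝ => Complex.exp (c * x)) := fun c =>
    (contDiff_const.mul hx).cexp
  have e : (fun x : ℝ => (2 * Real.pi * Complex.I / N : ℂ) * ((x : ℂ) * cardSinc (x / N))) =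
      fun x : ℝ => Complex.exp (Real.pi * Complex.I / N * x) +
        (-1) * Complex.exp (-(Real.pi * Complex.I / N) * x) := by
    ext x
    rw [mul_cardSinc_eq hN, ← mul_assoc, div_mul_div_cancel₀ hNc,
      div_self Complex.two_pi_I_ne_zero]
    have e1 : 2 * Real.pi * Complex.I * x * ((1 / (2 * N) : ℝ) : ℂ) =
        Real.pi * Complex.I / N * x := by
      push_cast
      field_simp
    have e2 : 2 * Real.pi * Complex.I * x * ((-(1 / (2 * N)) : ℝ) : ℂ) =
        -(Real.pi * Complex.I / N) * x := by
      push_cast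
      field_simp
    rw [e1, e2]
    ring
  have h := congrArg (taylorAt 0) e
  rw [taylorAt_mul contDiff_const (hx.mul hs), taylorAt_const, taylorAt_mul hx hs,
    taylorAt_zero_ofReal, taylorAt_add (hexp _) (contDiff_const.mul (hexp _)),
    taylorAt_mul contDiff_const (hexp _), taylorAt_const, taylorAt_zero_exp, taylorAt_zero_exp] at h
  rw [h, map_neg, map_one]
  ring

/-- With `S` the Taylor series of `sinc (x/N)`, the series `S⁻¹` satisfies the equation for `V`, so
`kernelSeries N n` agrees with `S⁻¹ ^ N` through degree `N - n`. -/
theorem X_pow_dvd_kernelSeries_mul_sub_one {N n : ℕ} (hN : 1 ≤ N) (hn : n ∈ Finset.Icc 1 N) :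
    PowerSeries.X ^ (N - n + 1) ∣
      kernelSeries N n * taylorAt 0 (fun x : ℝ => (cardSinc (x / N) : ℂ)) ^ N - 1 := by
  rw [Finset.mem_Icc] at hn
  set S := taylorAt 0 (fun x : ℝ => (cardSinc (x / N) : ℂ)) with hS
  have hS0 : PowerSeries.constantCoeff S ≠ 0 := by
    rw [← PowerSeries.coeff_zero_eq_constantCoeff_apply, hS, taylorAt, PowerSeries.coeff_mk]
    simp [cardSinc]
  have hVS : S⁻¹ * S = 1 := PowerSeries.inv_mul_cancel S hS0
  have hV : S⁻¹ * (expSeries (Real.pi * Complex.I / N) - expSeries (-(Real.pi * Complex.I / N))) =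
      PowerSeries.C (2 * Real.pi * Complex.I / N) * PowerSeries.X := by
    rw [← taylorAt_zero_cardSinc_mul hN]
    linear_combination (PowerSeries.C (2 * Real.pi * Complex.I / N) * PowerSeries.X) * hVS
  have hd : PowerSeries.X ^ (N - n + 1) ∣ kernelSeries N n - S⁻¹ ^ N := by
    rw [PowerSeries.X_pow_dvd_iff]
    intro r hr
    have hmem : N - r ∈ Finset.Icc n N := by
      rw [Finset.mem_Icc]
      omega
    rw [map_sub, sub_eq_zero, kernelSeries, map_sum, Finset.sum_eq_single_of_mem _ hmem]
    · have := coeff_pow_eq_nodeCoeff hN hV (m := N - r) (by rw [Finset.mem_Icc]; omega)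
      rw [Nat.sub_sub_self (by omega)] at this ⊢
      rw [this, PowerSeries.coeff_C_mul, PowerSeries.coeff_X_pow_self, mul_one]
    · intro m hm hne
      rw [Finset.mem_Icc] at hm
      rw [PowerSeries.coeff_C_mul, PowerSeries.coeff_X_pow, if_neg (by omega), mul_zero]
  have h2 : kernelSeries N n * S ^ N - 1 = (kernelSeries N n - S⁻¹ ^ N) * S ^ N := by
    rw [sub_mul, ← mul_pow, hVS, one_pow]
  rw [h2]
  exact hd.mul_right _

theorem iteratedDeriv_derivKernel_zero {N n : ℕ} (hN : 1 ≤ N) (hn : n ∈ Finset.Icc 1 N) {k : ℕ}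
    (hk : k < N) : iteratedDeriv k (derivKernel N n) 0 = if k = n - 1 then 1 else 0 := by
  obtain ⟨U, hU, hU0⟩ := taylorAt_derivKernel hN n 0
  obtain ⟨Q, hQ⟩ := X_pow_dvd_kernelSeries_mul_sub_one hN hn
  rw [Finset.mem_Icc] at hn
  rw [hU0 rfl] at hU
  -- The prefactor `X ^ (n - 1)` raises the truncation error to order `N`, invisible to derivatives
  -- of order below `N`.
  have h1 : taylorAt 0 (derivKernel N n) =
      PowerSeries.C (1 / (Nat.factorial (n - 1) : ℂ)) * PowerSeries.X ^ (n - 1) +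
        PowerSeries.X ^ N * (PowerSeries.C (1 / (Nat.factorial (n - 1) : ℂ)) * Q) := by
    have hX : (PowerSeries.X : PowerSeries ℂ) ^ N =
        PowerSeries.X ^ (n - 1) * PowerSeries.X ^ (N - n + 1) := by
      rw [← pow_add]
      congr 1
      omega
    rw [hU, hX]
    linear_combination (PowerSeries.C (1 / (Nat.factorial (n - 1) : ℂ)) *
      PowerSeries.X ^ (n - 1)) * hQ
  have h2 : PowerSeries.coeff k (PowerSeries.X ^ N *
      (PowerSeries.C (1 / (Nat.factorial (n - 1) : ℂ)) * Q)) = 0 :=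
    PowerSeries.X_pow_dvd_iff.1 (dvd_mul_right _ _) k hk
  have hf : (Nat.factorial (n - 1) : ℂ) ≠ 0 := by exact_mod_cast Nat.factorial_ne_zero _
  rw [iteratedDeriv_eq_coeff_taylorAt, h1, map_add, h2, add_zero, PowerSeries.coeff_C_mul,
    PowerSeries.coeff_X_pow]
  split_ifs with h
  · rw [h]
    field_simp
  · simp

theorem iteratedDeriv_derivKernel {N n : ℕ} (hN : 1 ≤ N) (hn : n ∈ Finset.Icc 1 N) {k : ℕ}
    (hk : k < N) (j : ℤ) :
    iteratedDeriv k (derivKernel N n) (N * j) = if k = n - 1 ∧ j = 0 then 1 else 0 := by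
  by_cases hj : j = 0
  · subst hj
    simpa using iteratedDeriv_derivKernel_zero hN hn hk
  · rw [iteratedDeriv_derivKernel_ne hN n hj hk, if_neg fun h => hj h.2]

/-! ### Square-summable samples and convergence of shift series. -/

theorem bandSynthesis_one {x : ℝ} : bandSynthesis (fun _ => 1) x = cardSinc x := by
  have h := integral_exp_Icc_eq_cardSinc (le_refl 1) x
  rw [integral_Icc_eq_integral_Ioc] at h
  simpa [bandSynthesis, bandMeasure] using h

/-- The samples are Fourier coefficients of `F` on the whole band, along the subfamily of indices
`-N m`; Parseval bounds them. -/
theorem summable_sq_samples {N : ℕ} (hN : 1 ≤ N) {F : ℝ → ℂ} (hF : MemLp F 2 bandMeasure) :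
    Summable fun m : ℤ => ‖bandSynthesis F (N * m)‖ ^ 2 := by
  have hab : (-(1 / 2) : ℝ) < 1 / 2 := by norm_num
  have h := (hasSum_sq_fourierCoeffOn hab hF).summable
  have hinj : Function.Injective fun m : ℤ => -((N : ℤ) * m) := by
    intro m m' hm
    have hN0 : (N : ℤ) ≠ 0 := by omega
    exact mul_left_cancel₀ hN0 (neg_injective hm)
  refine (h.comp_injective hinj).congr fun m => ?_
  simp only [Function.comp_apply]
  congr 2
  rw [fourierCoeffOn_eq_integral, intervalIntegral.integral_of_le hab.le, bandSynthesis,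
    bandMeasure, show (1 / (1 / 2 - -(1 / 2)) : ℝ) = 1 by norm_num, one_smul]
  congr 1
  ext ξ
  rw [fourier_coe_apply, neg_neg, smul_eq_mul]
  congr 2
  push_cast
  norm_num

/-- Multiplication by a bounded function on the band. -/
noncomputable def bandMul (c : ℝ → ℂ) (hc : AEStronglyMeasurable c bandMeasure) (C : ℝ)
    (hC : ∀ᵐ ξ ∂bandMeasure, ‖c ξ‖ ≤ C) : Lp ℂ 2 bandMeasure →L[ℂ] Lp ℂ 2 bandMeasure :=
  LinearMap.mkContinuous
    { toFun := fun F => (memLp_band_mul (Lp.memLp F) hc C hC).toLp _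
      map_add' := fun F G => by
        rw [← MemLp.toLp_add]
        apply MemLp.toLp_congr
        filter_upwards [Lp.coeFn_add F G] with ξ hξ
        simp only [hξ, Pi.add_apply, mul_add]
      map_smul' := fun a F => by
        rw [RingHom.id_apply, ← MemLp.toLp_const_smul]
        apply MemLp.toLp_congr
        filter_upwards [Lp.coeFn_smul a F] with ξ hξ
        simp only [hξ, Pi.smul_apply, smul_eq_mul]
        ring } C fun F => by
    apply Lp.norm_le_mul_norm_of_ae_le_mul
    filter_upwards [hC, (memLp_band_mul (Lp.memLp F) hc C hC).coeFn_toLp] with ξ hξ h2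
    simp only [LinearMap.coe_mk, AddHom.coe_mk, h2, norm_mul]
    exact mul_le_mul_of_nonneg_right hξ (norm_nonneg _)

theorem coeFn_bandMul {c : ℝ → ℂ} (hc : AEStronglyMeasurable c bandMeasure) {C : ℝ}
    (hC : ∀ᵐ ξ ∂bandMeasure, ‖c ξ‖ ≤ C) (F : Lp ℂ 2 bandMeasure) :
    bandMul c hc C hC F =ᵐ[bandMeasure] fun ξ => c ξ * F ξ :=
  (memLp_band_mul (Lp.memLp F) hc C hC).coeFn_toLp

/-- Evaluation at `x` of the function with spectral density `F`. -/
noncomputable def bandEval (x : ℝ) : Lp ℂ 2 bandMeasure →L[ℂ] ℂ :=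
  LinearMap.mkContinuous
    { toFun := fun F => bandSynthesis F x
      map_add' := fun F G => by
        rw [← bandSynthesis_add (Lp.memLp F) (Lp.memLp G), bandSynthesis_congr (Lp.coeFn_add F G)]
        rfl
      map_smul' := fun a F => by
        rw [RingHom.id_apply, smul_eq_mul, ← bandSynthesis_const_mul,
          bandSynthesis_congr (Lp.coeFn_smul a F)]
        rfl } 1 fun F => by
    rw [one_mul]
    exact norm_bandSynthesis_le (Lp.memLp F) x

theorem bandEval_apply (x : ℝ) (F : Lp ℂ 2 bandMeasure) : bandEval x F = bandSynthesis F x := rfl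

theorem norm_bandEval_le (x : ℝ) (F : Lp ℂ 2 bandMeasure) : ‖bandEval x F‖ ≤ ‖F‖ :=
  norm_bandSynthesis_le (Lp.memLp F) x

/-- Continuity of point derivatives in the spectral density is what permits differentiating the
series term by term. -/
theorem exists_clm_iteratedDeriv (k : ℕ) (x : ℝ) : ∃ L : Lp ℂ 2 bandMeasure →L[ℂ] ℂ,
    ∀ F : Lp ℂ 2 bandMeasure, L F = iteratedDeriv k (bandSynthesis F) x := by
  have hC : ∀ᵐ ξ : ℝ ∂bandMeasure, ‖(2 * Real.pi * Complex.I * ξ : ℂ) ^ k‖ ≤ Real.pi ^ k := by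
    filter_upwards [ae_bandMeasure_abs_le] with ξ hξ
    rw [norm_pow]
    exact pow_le_pow_left₀ (norm_nonneg _) (norm_frequency_le hξ) k
  refine ⟨(bandEval x).comp (bandMul (fun ξ : ℝ => (2 * Real.pi * Complex.I * ξ : ℂ) ^ k)
    (by fun_prop) (Real.pi ^ k) hC), fun F => ?_⟩
  rw [ContinuousLinearMap.comp_apply, bandEval_apply,
    bandSynthesis_congr (coeFn_bandMul _ hC F), iteratedDeriv_bandSynthesis (Lp.memLp F)]

theorem sum_bandSynthesis {ι : Type*} (u : ι → Lp ℂ 2 bandMeasure) (S : Finset ι) (x : ℝ) :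
    ∑ m ∈ S, bandSynthesis (u m) x = bandSynthesis (∑ m ∈ S, u m : Lp ℂ 2 bandMeasure) x := by
  simp only [← bandEval_apply, map_sum]

section Series

variable {ι : Type*} {u : ι → Lp ℂ 2 bandMeasure} {U : Lp ℂ 2 bandMeasure}

theorem tendstoUniformly_bandSynthesis (h : HasSum u U) :
    TendstoUniformly (fun (S : Finset ι) (x : ℝ) => ∑ m ∈ S, bandSynthesis (u m) x)
      (bandSynthesis U) Filter.atTop := by
  rw [Metric.tendstoUniformly_iff]
  intro ε hε
  have h' : Filter.Tendsto (fun S : Finset ι => ∑ m ∈ S, u m) Filter.atTop (nhds U) := h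
  filter_upwards [Metric.tendsto_nhds.1 h' ε hε] with S hS x
  rw [sum_bandSynthesis, ← bandEval_apply, ← bandEval_apply, dist_eq_norm, ← map_sub]
  refine (norm_bandEval_le x _).trans_lt ?_
  rwa [← dist_eq_norm, dist_comm]

theorem tendsto_eLpNorm_bandSynthesis (h : HasSum u U) :
    Filter.Tendsto (fun S : Finset ι => eLpNorm (fun x : ℝ => bandSynthesis U x -
      ∑ m ∈ S, bandSynthesis (u m) x) 2 volume) Filter.atTop (nhds 0) := by
  have h' : Filter.Tendsto (fun S : Finset ι => ∑ m ∈ S, u m) Filter.atTop (nhds U) := h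
  have h2 := (tendsto_const_nhds (x := U)).sub h'
  rw [sub_self] at h2
  have h3 := h2.enorm
  rw [enorm_zero] at h3
  refine h3.congr fun S => ?_
  have e : (fun x : ℝ => bandSynthesis U x - ∑ m ∈ S, bandSynthesis (u m) x) =
      bandSynthesis (U - ∑ m ∈ S, u m : Lp ℂ 2 bandMeasure) := by
    ext x
    rw [sum_bandSynthesis, ← bandEval_apply, ← bandEval_apply, ← bandEval_apply, map_sub]
  rw [e, eLpNorm_bandSynthesis (Lp.memLp _), Lp.enorm_def]

theorem hasSum_iteratedDeriv_bandSynthesis (h : HasSum u U) (k : ℕ) (x : ℝ) :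
    HasSum (fun m => iteratedDeriv k (bandSynthesis (u m)) x)
      (iteratedDeriv k (bandSynthesis U) x) := by
  obtain ⟨L, hL⟩ := exists_clm_iteratedDeriv k x
  simpa only [hL] using L.hasSum h

end Series

theorem memLp_spectral_exp (a : ℝ) :
    MemLp (fun ξ : ℝ => Complex.exp (-(2 * Real.pi * Complex.I * a * ξ))) 2 bandMeasure := by
  have h := memLp_spectral_exp_mul (memLp_const (1 : ℂ)) (-a)
  convert! h using 1
  ext ξ
  rw [mul_one]
  congr 1
  push_cast
  ring

/-- Inner products of these exponentials are values of `sinc` at integers. -/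
theorem orthonormal_spectral_exp {N : ℕ} (hN : 1 ≤ N) :
    Orthonormal ℂ fun m : ℤ => (memLp_spectral_exp (N * m)).toLp _ := by
  have hinner : ∀ m m' : ℤ, inner ℂ ((memLp_spectral_exp (N * m)).toLp _)
      ((memLp_spectral_exp (N * m')).toLp _) = (cardSinc (N * (m - m')) : ℂ) := by
    intro m m'
    rw [L2.inner_def, ← bandSynthesis_one, bandSynthesis]
    apply integral_congr_ae
    filter_upwards [(memLp_spectral_exp (N * m)).coeFn_toLp,
      (memLp_spectral_exp (N * m')).coeFn_toLp] with ξ h1 h2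
    rw [h1, h2, RCLike.inner_apply', ← Complex.exp_conj, mul_one, ← Complex.exp_add]
    congr 1
    simp only [map_neg, map_mul, Complex.conj_ofReal, Complex.conj_I, map_ofNat]
    push_cast
    ring
  rw [orthonormal_iff_ite]
  intro m m'
  rw [hinner]
  split_ifs with h
  · simp [h, cardSinc]
  · have := cardSinc_sample (le_refl 1) (j := N * (m - m'))
      (mul_ne_zero (by omega) (sub_ne_zero.2 h))
    push_cast at this
    rw [one_mul, div_one] at this
    rw [this, Complex.ofReal_zero]

/-- Shifting by `N m` multiplies the density by an exponential. The orthonormal series with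
square-summable coefficients converges, and multiplication by the bounded `φ` is continuous on `L²`;
boundedness of the density is used here. -/
theorem exists_hasSum_shifts {N : ℕ} (hN : 1 ≤ N) {φ : ℝ → ℂ} (hφ : Measurable φ) {C : ℝ}
    (hC : ∀ ξ, ‖φ ξ‖ ≤ C) {a : ℤ → ℂ} (ha : Summable fun m => ‖a m‖ ^ 2) :
    ∃ (u : ℤ → Lp ℂ 2 bandMeasure) (U : Lp ℂ 2 bandMeasure), HasSum u U ∧
      ∀ m k x, iteratedDeriv k (bandSynthesis (u m)) x =
        a m * iteratedDeriv k (bandSynthesis φ) (x - N * m) := by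
  have hv := orthonormal_spectral_exp hN
  have hs : Summable fun m : ℤ => a m • (memLp_spectral_exp (N * m)).toLp _ := by
    have := (hv.orthogonalFamily.summable_iff_norm_sq_summable a).2 ha
    simpa using this
  have hC' : ∀ᵐ ξ ∂bandMeasure, ‖φ ξ‖ ≤ C := .of_forall hC
  have hφL : MemLp φ 2 bandMeasure := MemLp.of_bound hφ.aestronglyMeasurable C hC'
  refine ⟨_, _, (bandMul φ hφ.aestronglyMeasurable C hC').hasSum hs.hasSum, fun m k x => ?_⟩
  rw [iteratedDeriv_bandSynthesis (Lp.memLp _), iteratedDeriv_bandSynthesis hφL,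
    bandSynthesis_comp_sub, ← bandSynthesis_const_mul]
  refine congrFun (bandSynthesis_congr ?_) x
  filter_upwards [coeFn_bandMul hφ.aestronglyMeasurable hC'
      (a m • (memLp_spectral_exp (N * m)).toLp _),
    Lp.coeFn_smul (a m) ((memLp_spectral_exp (N * m)).toLp _),
    (memLp_spectral_exp (N * m)).coeFn_toLp] with ξ h1 h2 h3
  rw [h1, h2, Pi.smul_apply, h3, smul_eq_mul]
  ring

/-! ### Interpolation formula. -/

theorem isPaleyWiener_derivKernel {N n : ℕ} (hN : 1 ≤ N) (hn : n ∈ Finset.Icc 1 N) :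
    IsPaleyWiener Real.pi (derivKernel N n) := by
  obtain ⟨φ, hφ, ⟨C, hC⟩, h⟩ := (hasBoundedSpectrum_derivKernel hN hn).exists_eq_bandSynthesis
  rw [h]
  exact isPaleyWiener_bandSynthesis (MemLp.of_bound hφ.aestronglyMeasurable C (.of_forall hC))

theorem IsPaleyWiener.contDiff {f : ℝ → ℂ} (hf : IsPaleyWiener Real.pi f) :
    ContDiff ℝ (⊤ : ℕ∞) f := by
  obtain ⟨F, hF, rfl⟩ := hf.exists_bandSynthesis
  exact contDiff_bandSynthesis hF

theorem IsPaleyWiener.summable_sq_samples {N : ℕ} (hN : 1 ≤ N) {f : ℝ → ℂ}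
    (hf : IsPaleyWiener Real.pi f) (k : ℕ) :
    Summable fun m : ℤ => ‖iteratedDeriv k f (N * m)‖ ^ 2 := by
  obtain ⟨F, hF, rfl⟩ := hf.exists_bandSynthesis
  rw [iteratedDeriv_bandSynthesis hF]
  exact _root_.summable_sq_samples hN (memLp_frequency_pow_mul hF k)

theorem IsPaleyWiener.exists_hasSum_derivTerm {N n : ℕ} (hN : 1 ≤ N) (hn : n ∈ Finset.Icc 1 N)
    {f : ℝ → ℂ} (hf : IsPaleyWiener Real.pi f) :
    ∃ (u : ℤ → Lp ℂ 2 bandMeasure) (U : Lp ℂ 2 bandMeasure), HasSum u U ∧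
      (∀ m, bandSynthesis (u m) = derivTerm N f n m) ∧
      ∀ k < N, ∀ j : ℤ, iteratedDeriv k (bandSynthesis U) (N * j) =
        if k = n - 1 then iteratedDeriv k f (N * j) else 0 := by
  obtain ⟨φ, hφ, ⟨C, hC⟩, h⟩ := (hasBoundedSpectrum_derivKernel hN hn).exists_eq_bandSynthesis
  obtain ⟨u, U, hU, hu⟩ := exists_hasSum_shifts hN hφ hC (hf.summable_sq_samples hN (n - 1))
  rw [← h] at hu
  refine ⟨u, U, hU, fun m => ?_, fun k hk j => ?_⟩
  · ext x
    simpa [derivTerm] using hu m 0 x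
  · refine (hasSum_iteratedDeriv_bandSynthesis hU k (N * j)).unique ?_
    -- By the delta property of the kernel only the shift `m = j` contributes, so the series of
    -- samples collapses.
    have hterm : ∀ m : ℤ, iteratedDeriv k (bandSynthesis (u m)) (N * j) =
        if m = j then (if k = n - 1 then iteratedDeriv k f (N * j) else 0) else 0 := by
      intro m
      have := iteratedDeriv_derivKernel hN hn hk (j - m)
      push_cast at this
      rw [hu, ← mul_sub, this]
      by_cases h1 : k = n - 1
      · by_cases h2 : m = j
        · simp [h1, h2]
        · have : ¬ j - m = 0 := fun h => h2 (sub_eq_zero.1 h).symm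
          simp [h2, this]
      · simp [h1]
    simp only [hterm]
    exact hasSum_ite_eq j _

theorem derivKernel_unique {N n : ℕ} (hN : 1 ≤ N) (hn : n ∈ Finset.Icc 1 N) {h : ℝ → ℂ}
    (hh : IsPaleyWiener Real.pi h) :
    (∀ k ∈ Finset.Icc 1 N, ∀ j : ℤ,
      iteratedDeriv (k - 1) h (N * j) = if k = n ∧ j = 0 then 1 else 0) ↔
      h = derivKernel N n := by
  have hn' := Finset.mem_Icc.1 hn
  constructor
  · intro hs
    apply hh.eq_of_samples_eq hN (isPaleyWiener_derivKernel hN hn)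
    intro k hk j
    have := hs (k + 1) (Finset.mem_Icc.2 ⟨by omega, hk⟩) j
    rw [Nat.add_sub_cancel] at this
    rw [this, iteratedDeriv_derivKernel hN hn hk]
    congr 2
    rw [eq_iff_iff]
    omega
  · rintro rfl k hk j
    rw [Finset.mem_Icc] at hk
    rw [iteratedDeriv_derivKernel hN hn (by omega)]
    congr 2
    rw [eq_iff_iff]
    omega

theorem mainTheorem5 (N : ℕ) (hN : 1 ≤ N) :
    -- the kernels lie in `PW_π` and are characterized there by their sampled data
    (∀ n ∈ Finset.Icc 1 N, IsPaleyWiener Real.pi (derivKernel N n) ∧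
      ∀ h : ℝ → ℂ, IsPaleyWiener Real.pi h →
        ((∀ k ∈ Finset.Icc 1 N, ∀ j : ℤ,
          iteratedDeriv (k - 1) h (N * j) = if k = n ∧ j = 0 then 1 else 0) ↔
        h = derivKernel N n)) ∧
    -- the interpolation formula
    ∀ f : ℝ → ℂ, IsPaleyWiener Real.pi f →
      ContDiff ℝ (⊤ : ℕ∞) f ∧
      (∀ x : ℝ, f x = ∑ n ∈ Finset.Icc 1 N, ∑' m : ℤ, derivTerm N f n m x) ∧
      -- for each `n` the series over `m` converges (unconditionally) uniformly and in `L²`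
      ∀ n ∈ Finset.Icc 1 N,
        TendstoUniformly (fun (F : Finset ℤ) (x : ℝ) => ∑ m ∈ F, derivTerm N f n m x)
          (fun x => ∑' m : ℤ, derivTerm N f n m x) Filter.atTop ∧
        Filter.Tendsto
          (fun F : Finset ℤ => MeasureTheory.eLpNorm
            (fun x : ℝ => (∑' m : ℤ, derivTerm N f n m x) - ∑ m ∈ F, derivTerm N f n m x)
            2 MeasureTheory.volume)
          Filter.atTop (nhds 0) := by
  refine ⟨fun n hn => ⟨isPaleyWiener_derivKernel hN hn, fun h hh => derivKernel_unique hN hn hh⟩,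
    fun f hf => ?_⟩
  have hex := fun n (hn : n ∈ Finset.Icc 1 N) => hf.exists_hasSum_derivTerm hN hn
  choose! u U hU hterm hsample using hex
  have hsum : ∀ n ∈ Finset.Icc 1 N, ∀ x : ℝ,
      ∑' m : ℤ, derivTerm N f n m x = bandSynthesis (U n) x := fun n hn x => by
    have := hasSum_iteratedDeriv_bandSynthesis (hU n hn) 0 x
    simp only [iteratedDeriv_zero, hterm n hn] at this
    exact this.tsum_eq
  refine ⟨hf.contDiff, ?_, fun n hn => ⟨?_, ?_⟩⟩
  · have key : f = bandSynthesis (∑ n ∈ Finset.Icc 1 N, U n : Lp ℂ 2 bandMeasure) := by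
      apply hf.eq_of_samples_eq hN (isPaleyWiener_bandSynthesis (Lp.memLp _))
      intro k hk j
      obtain ⟨L, hL⟩ := exists_clm_iteratedDeriv k (N * j)
      -- Derivative order `k` is carried by the kernel of index `k + 1`; all other series contribute
      -- zero to these samples.
      have hmem : k + 1 ∈ Finset.Icc 1 N := Finset.mem_Icc.2 ⟨by omega, hk⟩
      rw [← hL, map_sum, Finset.sum_eq_single_of_mem (k + 1) hmem, hL, hsample _ hmem k hk,
        Nat.add_sub_cancel, if_pos rfl]
      intro n hn hne
      rw [hL, hsample n hn k hk, if_neg]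
      rw [Finset.mem_Icc] at hn
      omega
    intro x
    rw [Finset.sum_congr rfl fun n hn => hsum n hn x, sum_bandSynthesis, ← key]
  · have := tendstoUniformly_bandSynthesis (hU n hn)
    simp only [hterm n hn] at this
    simpa only [hsum n hn] using this
  · have := tendsto_eLpNorm_bandSynthesis (hU n hn)
    simp only [hterm n hn] at this
    simpa only [hsum n hn] using this
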